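/- Let $n\ge 0$ and let $\mathbb Q\langle X_n\rangle=\mathbb Q\langle x_1,\dots,x_n\rangle$ be the ring of polynomials in $n$ noncommuting variables, on which $GL_n(\mathbb Q)$ acts by linear substitution of the variables. For a variable $x$ let $\partial_x$ be the Hausdorff derivative: the linear map sending a word $w$ to the sum, over all occurrences of the letter $x$ in $w$, of the word obtained from $w$ by deleting that occurrence. Let $$\mathcal A'_n=\bigcap_{x\in\{x_1,\dots,x_n\}}\ker\partial_x\subseteq\mathbb Q\langle X_n\rangle ,$$ the realization inside $\mathbb Q\langle X_n\rangle$ of the enveloping algebra of the derived free Lie algebra on $x_1,\dots,x_n$. It is a $GL_n(\mathbb Q)$-stable graded subspace with finite-dimensional homogeneous components. Its $GL_n(\mathbb Q)$-character is the formal power series in $a_1,\dots,a_n$ obtained by summing, over all degrees $k\ge0$, the polynomial in $a_1,\dots,a_n$ that gives the trace of $\mathrm{diag}(a_1,\dots,a_n)$ on the homogeneous component of degree $k$. Then, as formal power series, $$\mathrm{char}_{GL_n(\mathbb Q)}(\mathcal A'_n)(a_1,\dots,a_n)=\frac{(1-a_1)\cdots(1-a_n)}{1-(a_1+\cdots+a_n)}=1+\sum_{k\ge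 0}\ \sum_{i=2}^{k}(-1)^i\,e_{(i,1^{k-i})}(a_1,\dots,a_n),$$ where $e_{(i,1^{k-i})}=e_i\,e_1^{\,k-i}$ is a product of elementary symmetric polynomials (the inner sum is empty for $k<2$). Moreover this series is equal to $$\sum_T s_{\mathrm{shape}(T)}(a_1,\dots,a_n),$$ where $s_\lambda$ is the Schur polynomial (zero if $\lambda$ has more than $n$ rows) and the sum is over all standard Young tableaux $T$ (of every size, including the empty tableau) such that the smallest positive integer which does not appear in the first column of $T$ is odd. -/

import Mathlib

open scoped MvPowerSeries.WithPiTopology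

noncomputable section

namespace NCHarm

/-! ### Noncommutative polynomials and the Hausdorff derivatives -/

/-- The monomial `x_{w₁} x_{w₂} ⋯ x_{w_r}` of `ℚ⟨x₁, …, x_n⟩`. -/
def wordMonomial {n : ℕ} (w : List (Fin n)) : FreeAlgebra ℚ (Fin n) :=
  (w.map (FreeAlgebra.ι ℚ)).prod

/-- The Hausdorff derivative `∂_x`: the linear map sending a word `w` to the sum, over all
occurrences of the letter `x` in `w`, of the word `w` with that occurrence deleted. -/
def hausdorffDerivative {n : ℕ} (x : Fin n) :
    FreeAlgebra ℚ (Fin n) →ₗ[ℚ] FreeAlgebra ℚ (Fin n) :=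
  (FreeAlgebra.basisFreeMonoid ℚ (Fin n)).constr ℚ fun w =>
    ∑ i : Fin w.toList.length,
      if w.toList.get i = x then wordMonomial (w.toList.eraseIdx i) else 0

theorem basisFreeMonoid_eq_wordMonomial {n : ℕ} (w : FreeMonoid (Fin n)) :
    FreeAlgebra.basisFreeMonoid ℚ (Fin n) w = wordMonomial w.toList := by
  simp [FreeAlgebra.basisFreeMonoid, wordMonomial, FreeAlgebra.equivMonoidAlgebraFreeMonoid,
    FreeMonoid.lift_apply]

theorem hausdorffDerivative_wordMonomial {n : ℕ} (x : Fin n) (w : List (Fin n)) :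
    hausdorffDerivative x (wordMonomial w) =
      ∑ i : Fin w.length, if w.get i = x then wordMonomial (w.eraseIdx i) else 0 := by
  have h := basisFreeMonoid_eq_wordMonomial (FreeMonoid.ofList w)
  rw [FreeMonoid.toList_ofList] at h
  rw [← h, hausdorffDerivative, Module.Basis.constr_basis]
  rfl

theorem hausdorffDerivative_one {n : ℕ} (x : Fin n) : hausdorffDerivative x 1 = 0 := by
  have h := hausdorffDerivative_wordMonomial x []
  simpa [wordMonomial] using h

theorem linearMap_ext_wordMonomial {n : ℕ} {M : Type*} [AddCommGroup M] [Module ℚ M]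
    {φ ψ : FreeAlgebra ℚ (Fin n) →ₗ[ℚ] M}
    (h : ∀ w : List (Fin n), φ (wordMonomial w) = ψ (wordMonomial w)) : φ = ψ := by
  refine (FreeAlgebra.basisFreeMonoid ℚ (Fin n)).ext fun w => ?_
  rw [basisFreeMonoid_eq_wordMonomial, h]

theorem hausdorffDerivative_ι_mul {n : ℕ} (x y : Fin n) (f : FreeAlgebra ℚ (Fin n)) :
    hausdorffDerivative x (FreeAlgebra.ι ℚ y * f) =
      (if y = x then f else 0) + FreeAlgebra.ι ℚ y * hausdorffDerivative x f := by
  have key : (hausdorffDerivative x) ∘ₗ (LinearMap.mulLeft ℚ (FreeAlgebra.ι ℚ y)) =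
      (if y = x then LinearMap.id else 0) +
        (LinearMap.mulLeft ℚ (FreeAlgebra.ι ℚ y)) ∘ₗ (hausdorffDerivative x) := by
    apply linearMap_ext_wordMonomial
    intro w
    have e : FreeAlgebra.ι ℚ y * wordMonomial w = wordMonomial (y :: w) := by
      simp [wordMonomial]
    simp only [LinearMap.comp_apply, LinearMap.mulLeft_apply, LinearMap.add_apply, e,
      hausdorffDerivative_wordMonomial]
    refine (Fin.sum_univ_succ (n := w.length) fun i =>
      if (y :: w).get i = x then wordMonomial ((y :: w).eraseIdx i) else 0).trans ?_
    congr 1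
    · split_ifs <;> simp_all
    · rw [Finset.mul_sum]
      refine Finset.sum_congr rfl fun i _ => ?_
      split_ifs <;> simp_all [wordMonomial]
  have := LinearMap.congr_fun key f
  simp only [LinearMap.comp_apply, LinearMap.mulLeft_apply, LinearMap.add_apply] at this
  rw [this]
  split_ifs <;> simp

theorem hausdorffDerivative_ι {n : ℕ} (x y : Fin n) :
    hausdorffDerivative x (FreeAlgebra.ι ℚ y) = if y = x then 1 else 0 := by
  have h := hausdorffDerivative_ι_mul x y 1
  simpa [hausdorffDerivative_one] using h

theorem hausdorffDerivative_mul {n : ℕ} (x : Fin n) (f g : FreeAlgebra ℚ (Fin n)) :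
    hausdorffDerivative x (f * g) =
      hausdorffDerivative x f * g + f * hausdorffDerivative x g := by
  have key : (hausdorffDerivative x) ∘ₗ (LinearMap.mulRight ℚ g) =
      (LinearMap.mulRight ℚ g) ∘ₗ (hausdorffDerivative x) +
        LinearMap.mulRight ℚ (hausdorffDerivative x g) := by
    apply linearMap_ext_wordMonomial
    intro w
    simp only [LinearMap.comp_apply, LinearMap.mulRight_apply, LinearMap.add_apply]
    induction w with
    | nil => simp [wordMonomial, hausdorffDerivative_one]
    | cons y w ih =>
      have e : wordMonomial (y :: w) = FreeAlgebra.ι ℚ y * wordMonomial w := by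
        simp [wordMonomial]
      rw [e, mul_assoc, hausdorffDerivative_ι_mul, ih, hausdorffDerivative_ι_mul]
      split_ifs <;> noncomm_ring
  exact LinearMap.congr_fun key f

/-! ### The action of `GL_n(ℚ)` and the module `𝒜'_n` -/

/-- The algebra endomorphism of `ℚ⟨x₁, …, x_n⟩` with `x_j ↦ ∑ i, g i j • x_i`. -/
def substHom {n : ℕ} (g : Matrix (Fin n) (Fin n) ℚ) :
    FreeAlgebra ℚ (Fin n) →ₐ[ℚ] FreeAlgebra ℚ (Fin n) :=
  FreeAlgebra.lift ℚ fun j => ∑ i, g i j • FreeAlgebra.ι ℚ i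

theorem substHom_ι {n : ℕ} (g : Matrix (Fin n) (Fin n) ℚ) (j : Fin n) :
    substHom g (FreeAlgebra.ι ℚ j) = ∑ i, g i j • FreeAlgebra.ι ℚ i := by
  simp [substHom]

/-- The canonical action of `GL_n(ℚ)` on `ℚ⟨x₁, …, x_n⟩` by linear substitutions. -/
def glRep (n : ℕ) : Representation ℚ (GL (Fin n) ℚ) (FreeAlgebra ℚ (Fin n)) where
  toFun g := (substHom (g : Matrix (Fin n) (Fin n) ℚ)).toLinearMap
  map_one' := by
    have : substHom (1 : Matrix (Fin n) (Fin n) ℚ) = AlgHom.id ℚ _ := by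
      apply FreeAlgebra.hom_ext
      funext j
      simp [substHom_ι, Matrix.one_apply]
    simp only [Units.val_one, this]
    rfl
  map_mul' g h := by
    have : substHom ((g : Matrix (Fin n) (Fin n) ℚ) * (h : Matrix (Fin n) (Fin n) ℚ)) =
        (substHom (g : Matrix (Fin n) (Fin n) ℚ)).comp
          (substHom (h : Matrix (Fin n) (Fin n) ℚ)) := by
      apply FreeAlgebra.hom_ext
      funext j
      simp only [Function.comp_apply, AlgHom.comp_apply, substHom_ι, map_sum, map_smul,
        Matrix.mul_apply, Finset.sum_smul, Finset.smul_sum]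
      rw [Finset.sum_comm]
      refine Finset.sum_congr rfl fun l _ => Finset.sum_congr rfl fun i _ => ?_
      rw [smul_smul, mul_comm]
    simp only [Units.val_mul, this]
    rfl

theorem glRep_mul {n : ℕ} (g : GL (Fin n) ℚ) (f h : FreeAlgebra ℚ (Fin n)) :
    glRep n g (f * h) = glRep n g f * glRep n g h :=
  map_mul (substHom (g : Matrix (Fin n) (Fin n) ℚ)) f h

theorem glRep_ι {n : ℕ} (g : GL (Fin n) ℚ) (j : Fin n) :
    glRep n g (FreeAlgebra.ι ℚ j) =
      ∑ i, (g : Matrix (Fin n) (Fin n) ℚ) i j • FreeAlgebra.ι ℚ i :=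
  substHom_ι _ j

theorem glRep_algebraMap {n : ℕ} (g : GL (Fin n) ℚ) (r : ℚ) :
    glRep n g (algebraMap ℚ _ r) = algebraMap ℚ _ r :=
  (substHom (g : Matrix (Fin n) (Fin n) ℚ)).commutes r

/-- Chain rule. -/
theorem hausdorffDerivative_glRep {n : ℕ} (g : GL (Fin n) ℚ) (x : Fin n)
    (f : FreeAlgebra ℚ (Fin n)) :
    hausdorffDerivative x (glRep n g f) =
      ∑ j, (g : Matrix (Fin n) (Fin n) ℚ) x j • glRep n g (hausdorffDerivative j f) := by
  induction f using FreeAlgebra.induction with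
  | grade0 r =>
    rw [glRep_algebraMap]
    simp [Algebra.algebraMap_eq_smul_one, hausdorffDerivative_one]
  | grade1 y =>
    have h1 : glRep n g 1 = 1 := by simpa using glRep_algebraMap g 1
    have h2 : ∀ j, glRep n g (hausdorffDerivative j (FreeAlgebra.ι ℚ y)) =
        if y = j then 1 else 0 := by
      intro j
      rw [hausdorffDerivative_ι]
      split_ifs <;> simp [h1]
    simp only [h2, glRep_ι]
    simp [hausdorffDerivative_ι]
  | mul a b ha hb =>
    simp only [glRep_mul, hausdorffDerivative_mul, map_add, ha, hb, smul_add,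
      Finset.sum_add_distrib, Finset.sum_mul, Finset.mul_sum, smul_mul_assoc, mul_smul_comm]
  | add a b ha hb =>
    simp only [map_add, ha, hb, smul_add, Finset.sum_add_distrib]

/-- `𝒜'_n = ⋂ ker ∂_x`, the enveloping algebra of the derived free Lie algebra realized inside
`ℚ⟨x₁, …, x_n⟩`, with its action of `GL_n(ℚ)`. -/
def derivedEnveloping (n : ℕ) : Subrepresentation (glRep n) where
  toSubmodule := ⨅ x : Fin n, LinearMap.ker (hausdorffDerivative x)
  apply_mem_toSubmodule g f hf := by
    simp only [Submodule.mem_iInf, LinearMap.mem_ker] at hf ⊢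
    intro x
    simp [hausdorffDerivative_glRep, hf]

/-- The homogeneous noncommutative polynomials of degree `k`: the span of all products of `k`
variables. -/
def homogeneousPart (n k : ℕ) : Subrepresentation (glRep n) where
  toSubmodule := (Submodule.span ℚ (Set.range (FreeAlgebra.ι ℚ : Fin n → _))) ^ k
  apply_mem_toSubmodule g f hf := by
    have h1 : Submodule.map (substHom (g : Matrix (Fin n) (Fin n) ℚ)).toLinearMap
        (Submodule.span ℚ (Set.range (FreeAlgebra.ι ℚ : Fin n → _))) ≤
        Submodule.span ℚ (Set.range (FreeAlgebra.ι ℚ : Fin n → _)) := by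
      rw [Submodule.map_span, Submodule.span_le]
      rintro _ ⟨_, ⟨j, rfl⟩, rfl⟩
      simp only [AlgHom.toLinearMap_apply, substHom_ι]
      exact Submodule.sum_mem _ fun i _ =>
        Submodule.smul_mem _ _ (Submodule.subset_span ⟨i, rfl⟩)
    have h2 := Submodule.mem_map_of_mem
      (f := (substHom (g : Matrix (Fin n) (Fin n) ℚ)).toLinearMap) hf
    rw [Submodule.map_pow] at h2
    exact pow_le_pow_left' h1 k h2

/-- The homogeneous component of degree `k` of `𝒜'_n`. -/
def derivedEnvelopingPart (n k : ℕ) : Subrepresentation (glRep n) :=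
  derivedEnveloping n ⊓ homogeneousPart n k

instance (n k : ℕ) : FiniteDimensional ℚ (derivedEnvelopingPart n k).toSubmodule := by
  have h : (homogeneousPart n k).toSubmodule.FG :=
    Submodule.FG.pow (Submodule.fg_span (Set.finite_range _)) k
  have : FiniteDimensional ℚ (homogeneousPart n k).toSubmodule := Module.Finite.iff_fg.mpr h
  exact Submodule.finiteDimensional_of_le
    (inf_le_right : (derivedEnveloping n).toSubmodule ⊓ (homogeneousPart n k).toSubmodule ≤ _)

/-- The diagonal matrix `diag(a₁, …, a_n)` as an element of `GL_n(ℚ)`. -/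
def diagGL {n : ℕ} (a : Fin n → ℚˣ) : GL (Fin n) ℚ where
  val := Matrix.diagonal fun i => (a i : ℚ)
  inv := Matrix.diagonal fun i => ((a i)⁻¹ : ℚˣ)
  val_inv := by simp [Matrix.diagonal_mul_diagonal]
  inv_val := by simp [Matrix.diagonal_mul_diagonal]

/-- `χ` is the `GL_n(ℚ)`-character of `𝒜'_n`: the sum over all degrees `k` of the polynomials in
`a₁, …, a_n` giving the trace of `diag(a₁, …, a_n)` on the homogeneous component of degree `k`. -/
def IsCharacterDerivedEnveloping (n : ℕ) (χ : MvPowerSeries (Fin n) ℚ) : Prop :=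
  ∃ p : ℕ → MvPolynomial (Fin n) ℚ,
    (∀ (k : ℕ) (a : Fin n → ℚˣ),
      (derivedEnvelopingPart n k).toRepresentation.character (diagGL a) =
        MvPolynomial.eval (fun i => (a i : ℚ)) (p k)) ∧
    HasSum (fun k => (p k : MvPowerSeries (Fin n) ℚ)) χ

/-! ### Symmetric polynomials -/

/-- The elementary symmetric polynomial `e_{(i, 1^{k-i})}(a₁, …, a_n)`, for `i ≤ k`. -/
def elementaryHook (n k i : ℕ) : MvPolynomial (Fin n) ℚ :=
  MvPolynomial.esymmPart (Fin n) ℚ (Nat.Partition.ofMultiset (i ::ₘ Multiset.replicate (k - i) 1))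

/-- The alternant `det (a_i ^ {f_j})`. -/
def alternant {n : ℕ} (f : Fin n → ℕ) : MvPolynomial (Fin n) ℚ :=
  (Matrix.of fun i j : Fin n => (MvPolynomial.X i : MvPolynomial (Fin n) ℚ) ^ f j).det

/-- The staircase `δ = (n-1, n-2, …, 0)`. -/
def staircase (n : ℕ) (j : Fin n) : ℕ := n - 1 - j

theorem vandermonde_dvd_alternant {n : ℕ} (f : Fin n → ℕ) :
    (Matrix.vandermonde (MvPolynomial.X : Fin n → MvPolynomial (Fin n) ℚ)).det ∣ alternant f := by
  let P : Polynomial (MvPolynomial (Fin n) ℚ) :=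
    ∏ l : Fin n, (Polynomial.X - Polynomial.C (MvPolynomial.X l))
  have hP : P.Monic := Polynomial.monic_prod_X_sub_C _ _
  have hdeg : P.natDegree = n := by
    simp [P]
  let C : Matrix (Fin n) (Fin n) (MvPolynomial (Fin n) ℚ) :=
    Matrix.of fun k j => ((Polynomial.X ^ f j : Polynomial (MvPolynomial (Fin n) ℚ)) %ₘ P).coeff k
  have hM : (Matrix.of fun i j : Fin n => (MvPolynomial.X i : MvPolynomial (Fin n) ℚ) ^ f j) =
      Matrix.vandermonde (MvPolynomial.X : Fin n → MvPolynomial (Fin n) ℚ) * C := by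
    ext1 i j
    have hroot : P.eval (MvPolynomial.X i) = 0 := by
      simp only [P, Polynomial.eval_prod]
      exact Finset.prod_eq_zero (Finset.mem_univ i) (by simp)
    have hlt : ((Polynomial.X ^ f j : Polynomial (MvPolynomial (Fin n) ℚ)) %ₘ P).natDegree < n := by
      have h := Polynomial.natDegree_modByMonic_lt
        (Polynomial.X ^ f j : Polynomial (MvPolynomial (Fin n) ℚ)) hP (by
          intro h1
          have := i.pos
          rw [h1, Polynomial.natDegree_one] at hdeg
          omega)
      rwa [hdeg] at h
    have h1 : ((Polynomial.X ^ f j : Polynomial (MvPolynomial (Fin n) ℚ)) %ₘ P).eval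
        (MvPolynomial.X i) = MvPolynomial.X i ^ f j := by
      have h := congrArg (Polynomial.eval (MvPolynomial.X i))
        (Polynomial.modByMonic_add_div (Polynomial.X ^ f j) P)
      simpa [hroot] using h
    rw [Polynomial.eval_eq_sum_range' hlt, ← Fin.sum_univ_eq_sum_range
      (fun k => ((Polynomial.X ^ f j : Polynomial (MvPolynomial (Fin n) ℚ)) %ₘ P).coeff k *
        MvPolynomial.X i ^ k)] at h1
    simp only [Matrix.of_apply, Matrix.mul_apply, Matrix.vandermonde_apply, C, ← h1]
    exact Finset.sum_congr rfl fun k _ => mul_comm _ _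
  rw [alternant, hM, Matrix.det_mul]
  exact dvd_mul_right _ _

theorem alternant_staircase_dvd {n : ℕ} (f : Fin n → ℕ) :
    alternant (staircase n) ∣ alternant f := by
  have h : alternant (staircase n) =
      (Equiv.Perm.sign (Fin.revPerm : Equiv.Perm (Fin n)) : MvPolynomial (Fin n) ℚ) *
        (Matrix.vandermonde (MvPolynomial.X : Fin n → MvPolynomial (Fin n) ℚ)).det := by
    rw [← Matrix.det_permute', alternant]
    congr 1
    ext1 i j
    simp only [Matrix.of_apply, Matrix.submatrix_apply, Matrix.vandermonde_apply, staircase, id,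
      Fin.revPerm_apply, Fin.val_rev]
    congr 1
    omega
  rw [h]
  refine (IsUnit.mul_left_dvd ?_).mpr (vandermonde_dvd_alternant f)
  rcases Int.units_eq_one_or (Equiv.Perm.sign (Fin.revPerm : Equiv.Perm (Fin n))) with h | h <;>
    simp [h]

/-- The Schur polynomial `s_μ(a₁, …, a_n)`: the quotient `a_{μ+δ} / a_δ` of alternants if `μ` has
at most `n` rows, and `0` otherwise. -/
def schurPoly (n : ℕ) (μ : YoungDiagram) : MvPolynomial (Fin n) ℚ :=
  if μ.colLen 0 ≤ n then
    (alternant_staircase_dvd fun j : Fin n => μ.rowLen j + staircase n j).choose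
  else 0

theorem alternant_staircase_mul_schurPoly {n : ℕ} {μ : YoungDiagram} (h : μ.colLen 0 ≤ n) :
    alternant (staircase n) * schurPoly n μ =
      alternant fun j : Fin n => μ.rowLen j + staircase n j := by
  rw [schurPoly, if_pos h]
  exact (alternant_staircase_dvd fun j : Fin n => μ.rowLen j + staircase n j).choose_spec.symm

theorem alternant_staircase_ne_zero (n : ℕ) : alternant (staircase n) ≠ 0 := by
  intro h0
  have h : (Matrix.vandermonde (MvPolynomial.X : Fin n → MvPolynomial (Fin n) ℚ)).det = 0 := by
    have h := alternant_staircase_dvd (fun j : Fin n => (j : ℕ))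
    rw [h0, zero_dvd_iff] at h
    exact h
  exact Matrix.det_vandermonde_ne_zero_iff.mpr (MvPolynomial.X_injective) h

/-! ### Standard tableaux -/

/-- A standard Young tableau of shape `μ`: the cells of `μ` are filled bijectively with
`1, …, |μ|`, increasing along rows and columns. Entries outside `μ` are set to `0`. -/
structure StandardTableau (μ : YoungDiagram) where
  entry : ℕ → ℕ → ℕ
  row_strict : ∀ {i j₁ j₂ : ℕ}, j₁ < j₂ → (i, j₂) ∈ μ → entry i j₁ < entry i j₂
  col_strict : ∀ {i₁ i₂ j : ℕ}, i₁ < i₂ → (i₂, j) ∈ μ → entry i₁ j < entry i₂ j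
  bijOn : Set.BijOn (fun c : ℕ × ℕ => entry c.1 c.2) (μ.cells : Set (ℕ × ℕ)) (Set.Icc 1 μ.card)
  zeros : ∀ {i j : ℕ}, (i, j) ∉ μ → entry i j = 0

/-- The smallest positive integer which does not appear in the first column of `T`. -/
def StandardTableau.firstMissing {μ : YoungDiagram} (T : StandardTableau μ) : ℕ :=
  sInf {m : ℕ | 1 ≤ m ∧ ∀ i : ℕ, (i, 0) ∈ μ → T.entry i 0 ≠ m}

end NCHarm

end

/-!
All three series have constant term `1`, and the degree `k + 1` part of each of them is
`c_{k+1} = e₁ c_k + (-1)^{k+1} e_{k+1}`, so that `c_k = ∑_{i ≤ k} (-1)^i e_i e₁^{k-i}`.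

For the character, integration by parts shows that `∂_x` maps the common constants of any set of
derivatives not containing `∂_x` onto themselves. Since `∂_x` lowers the degree by one and
scales the action of `diag(a₁, …, a_n)` by `a_x`, imposing `∂_x = 0` multiplies the generating
series of the traces by `1 - a_x t`; without any condition this series is `1 / (1 - ∑ a_i t)`.

For tableaux, multiplication by `e₁` is, by Pieri's rule, the addition of a cell with the largest
entry. This changes the smallest entry missing from the first column only when a tableau whose
shape is a column grows at its bottom, and the parity change for this one tableau contributes the
term `± s_{(1^{k+1})} = ± e_{k+1}`.
-/

noncomputable section

namespace NCHarm

open Finset MvPolynomial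

/-! ### Series of polynomials -/

section Series

variable {σ : Type*}

theorem aeval_X_eq_toMvPowerSeries {R : Type*} [CommSemiring R] (p : MvPolynomial σ R) :
    aeval MvPowerSeries.X p = (p : MvPowerSeries σ R) := by
  induction p using MvPolynomial.induction_on with
  | C r => rw [aeval_C, coe_C]; rfl
  | add p q hp hq => rw [map_add, hp, hq, MvPolynomial.coe_add]
  | mul_X p i hp => rw [map_mul, hp, aeval_X, MvPolynomial.coe_mul, coe_X]

theorem hasSum_pow_of_constantCoeff_eq_zero {K : Type*} [Field K] [TopologicalSpace K]
    [IsTopologicalRing K] [T2Space K] {f : MvPowerSeries σ K} (hf : f.constantCoeff = 0) :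
    HasSum (fun k => f ^ k) (1 - f)⁻¹ := by
  rw [← (MvPowerSeries.eq_inv_iff_mul_eq_one (by simp [hf])).mpr
    (MvPowerSeries.WithPiTopology.tsum_pow_mul_one_sub_of_constantCoeff_eq_zero hf)]
  exact (MvPowerSeries.WithPiTopology.summable_pow_of_constantCoeff_eq_zero hf).hasSum

theorem hasSum_ite_le_sub {M : Type*} [AddCommMonoid M] [TopologicalSpace M] {f : ℕ → M} {s : M}
    (hf : HasSum f s) (i : ℕ) : HasSum (fun k => if i ≤ k then f (k - i) else 0) s := by
  refine ((add_left_injective i).hasSum_iff fun k hk => if_neg fun hik => hk ?_).mp ?_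
  · exact ⟨k - i, Nat.sub_add_cancel hik⟩
  · simpa [Function.comp_def] using hf

end Series

/-! ### Alternating sums of elementary symmetric polynomials -/

section AlternatingHookSum

variable {σ R : Type*} [Fintype σ] [CommRing R]

theorem prod_one_sub_eq_sum_aeval_esymm {A : Type*} [CommRing A] [Algebra R A] (f : σ → A) :
    ∏ i, (1 - f i) = ∑ k ∈ range (Fintype.card σ + 1), (-1) ^ k * aeval f (esymm σ R k) := by
  simp only [sub_eq_add_neg, prod_one_add, sum_powerset, card_univ, prod_neg, esymm, map_sum,
    map_prod, aeval_X, mul_sum]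
  exact sum_congr rfl fun k _ => sum_congr rfl fun S hS => by rw [(mem_powersetCard.mp hS).2]

theorem esymm_eq_zero_of_card_lt {k : ℕ} (hk : Fintype.card σ < k) : esymm σ R k = 0 := by
  rw [esymm, powersetCard_eq_empty.mpr (by simpa using hk), sum_empty]

variable (σ R) in
/-- The degree `k` part `∑_{i ≤ k} (-1)^i e_i e_1^{k-i}` of `∏_i (1 - a_i) / (1 - ∑_i a_i)`. -/
def alternatingHookSum (k : ℕ) : MvPolynomial σ R :=
  ∑ i ∈ range (k + 1), (-1) ^ i * (esymm σ R i * (∑ j, X j) ^ (k - i))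

theorem alternatingHookSum_zero : alternatingHookSum σ R 0 = 1 := by
  simp [alternatingHookSum]

theorem alternatingHookSum_succ (k : ℕ) :
    alternatingHookSum σ R (k + 1) =
      (∑ j, X j) * alternatingHookSum σ R k + (-1) ^ (k + 1) * esymm σ R (k + 1) := by
  have hterm : ∀ i ∈ range (k + 1), (-1) ^ i * (esymm σ R i * (∑ j, X j) ^ (k + 1 - i)) =
      (∑ j, X j) * ((-1) ^ i * (esymm σ R i * (∑ j, X j) ^ (k - i))) := fun i hi => by
    rw [Nat.succ_sub (mem_range_succ_iff.mp hi), pow_succ]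
    ring
  rw [alternatingHookSum, sum_range_succ, sum_congr rfl hterm, ← mul_sum, Nat.sub_self, pow_zero,
    mul_one, alternatingHookSum]

theorem toMvPowerSeries_alternatingHookSum (k : ℕ) :
    (alternatingHookSum σ R k : MvPowerSeries σ R) =
      ∑ i ∈ range (k + 1), (-1) ^ i * ((esymm σ R i : MvPowerSeries σ R) *
        (∑ j, MvPowerSeries.X j) ^ (k - i)) := by
  simp only [alternatingHookSum, ← coeToMvPowerSeries.ringHom_apply, map_sum, map_mul, map_pow,
    map_neg, map_one]
  simp only [coeToMvPowerSeries.ringHom_apply, coe_X]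

/-- The `i = 0` and `i = 1` terms of `alternatingHookSum` cancel in positive degree. -/
theorem alternatingHookSum_eq_ite_add_sum_Icc (k : ℕ) :
    alternatingHookSum σ R k = (if k = 0 then 1 else 0) +
      ∑ i ∈ Icc 2 k, (-1) ^ i * (esymm σ R i * (∑ j, X j) ^ (k - i)) := by
  rcases k with _ | k
  · simp [alternatingHookSum_zero]
  · rw [alternatingHookSum, ← sum_range_add_sum_Ico _ (show 2 ≤ k + 1 + 1 by lia),
      if_neg k.succ_ne_zero]
    congr 1
    simp [sum_range_succ, esymm_one, pow_succ']

variable {K : Type*} [Field K] [TopologicalSpace K] [IsTopologicalRing K] [T2Space K]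

theorem hasSum_alternatingHookSum :
    HasSum (fun k => (alternatingHookSum σ K k : MvPowerSeries σ K))
      ((∏ i, (1 - MvPowerSeries.X i)) * (1 - ∑ i, MvPowerSeries.X i)⁻¹) := by
  have hgeom := hasSum_pow_of_constantCoeff_eq_zero
    (f := (∑ i : σ, MvPowerSeries.X i : MvPowerSeries σ K)) (by simp)
  rw [prod_one_sub_eq_sum_aeval_esymm (R := K), sum_mul]
  refine (hasSum_sum fun i _ => (hasSum_ite_le_sub hgeom i).mul_left _).congr_fun fun k => ?_
  rw [toMvPowerSeries_alternatingHookSum]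
  refine sum_congr_of_eq_on_inter (fun i _ hi => ?_) (fun i _ hi => ?_) fun i hi _ => ?_
  · rw [esymm_eq_zero_of_card_lt (by simpa using hi), MvPolynomial.coe_zero, zero_mul, mul_zero]
  · rw [if_neg (by simpa using hi), mul_zero]
  · rw [if_pos (mem_range_succ_iff.mp hi), aeval_X_eq_toMvPowerSeries, mul_assoc]

end AlternatingHookSum

theorem elementaryHook_eq {n k i : ℕ} (hi : i ≠ 0) :
    elementaryHook n k i = esymm (Fin n) ℚ i * (∑ j, X j) ^ (k - i) := by
  rw [elementaryHook, esymmPart, Nat.Partition.ofMultiset_parts,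
    Multiset.filter_eq_self.mpr (by simp +contextual [hi, Multiset.mem_replicate]),
    Multiset.map_cons, Multiset.prod_cons, Multiset.map_replicate, Multiset.prod_replicate,
    esymm_one]

theorem alternatingHookSum_eq_ite_add_sum_elementaryHook (n k : ℕ) :
    alternatingHookSum (Fin n) ℚ k =
      (if k = 0 then 1 else 0) + ∑ i ∈ Icc 2 k, (-1) ^ i * elementaryHook n k i := by
  rw [alternatingHookSum_eq_ite_add_sum_Icc]
  refine congrArg _ (sum_congr rfl fun i hi => ?_)
  rw [elementaryHook_eq (by have := mem_Icc.mp hi; lia)]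

theorem hasSum_sum_elementaryHook (n : ℕ) :
    HasSum
      (fun k : ℕ => ∑ i ∈ Icc 2 k,
        (-1 : MvPowerSeries (Fin n) ℚ) ^ i * (elementaryHook n k i : MvPowerSeries (Fin n) ℚ))
      ((∏ i : Fin n, (1 - MvPowerSeries.X i)) * (1 - ∑ i : Fin n, MvPowerSeries.X i)⁻¹ - 1) := by
  have h := (hasSum_alternatingHookSum (σ := Fin n) (K := ℚ)).sub
    (hasSum_ite_eq 0 (1 : MvPowerSeries (Fin n) ℚ))
  refine h.congr_fun fun k => ?_
  simp only [alternatingHookSum_eq_ite_add_sum_elementaryHook,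
    ← coeToMvPowerSeries.ringHom_apply, map_add, map_sum, map_mul, map_pow, map_neg, map_one,
    apply_ite coeToMvPowerSeries.ringHom, map_zero, add_sub_cancel_left]

/-! ### Traces -/

section Trace

variable {R M N K : Type*} [CommRing R] [AddCommGroup M] [Module R M] [AddCommGroup N] [Module R N]
  [AddCommGroup K] [Module R K]

theorem trace_eq_sum_of_basis_eigenvectors {ι : Type*} [Fintype ι] (b : Module.Basis ι R M)
    {φ : M →ₗ[R] M} {c : ι → R} (h : ∀ i, φ (b i) = c i • b i) :
    LinearMap.trace R M φ = ∑ i, c i := by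
  classical
  simp [LinearMap.trace_eq_matrix_trace R b, Matrix.trace, LinearMap.toMatrix_apply, h]

theorem trace_restrict_congr {p q : Submodule R M} (h : p = q) (φ : M →ₗ[R] M)
    (hp : ∀ m ∈ p, φ m ∈ p) (hq : ∀ m ∈ q, φ m ∈ q) :
    LinearMap.trace R p (φ.restrict hp) = LinearMap.trace R q (φ.restrict hq) := by
  subst h
  rfl

theorem trace_eq_add_of_exact [Module.Free R M] [Module.Finite R M] [Module.Free R N]
    [Module.Finite R N] [Module.Free R K] [Module.Finite R K] {i : K →ₗ[R] M} {f : M →ₗ[R] N}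
    (hi : Function.Injective i) (hf : Function.Surjective f) (hexact : Function.Exact i f)
    {κ : K →ₗ[R] K} {φ : M →ₗ[R] M} {ψ : N →ₗ[R] N} (hκ : φ ∘ₗ i = i ∘ₗ κ)
    (hψ : f ∘ₗ φ = ψ ∘ₗ f) :
    LinearMap.trace R M φ = LinearMap.trace R K κ + LinearMap.trace R N ψ := by
  obtain ⟨s, hs⟩ := Module.projective_lifting_property f LinearMap.id hf
  obtain ⟨e, rfl, rfl⟩ : ∃ e : M ≃ₗ[R] K × N,
      i = e.symm ∘ₗ LinearMap.inl R K N ∧ f = LinearMap.snd R K N ∘ₗ e :=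
    ⟨_, (hexact.splitSurjectiveEquiv hi ⟨s, hs⟩).2⟩
  have hφ : φ = (φ ∘ₗ e.symm ∘ₗ LinearMap.inl R K N) ∘ₗ LinearMap.fst R K N ∘ₗ e +
      (φ ∘ₗ e.symm ∘ₗ LinearMap.inr R K N) ∘ₗ LinearMap.snd R K N ∘ₗ e := by
    ext m
    simp [← map_add]
  rw [hφ, map_add, hκ, LinearMap.trace_comp_comm' (LinearMap.fst R K N ∘ₗ e.toLinearMap),
    LinearMap.trace_comp_comm' (LinearMap.snd R K N ∘ₗ e.toLinearMap),
    ← LinearMap.comp_assoc _ φ, hψ]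
  congr 2 <;> ext <;> simp

theorem trace_restrict_eq_add_of_map_eq {F V W : Type*} [Field F] [AddCommGroup V] [Module F V]
    [AddCommGroup W] [Module F W] {p p₀ : Submodule F V} {q : Submodule F W} [FiniteDimensional F p]
    {f : V →ₗ[F] W} (hmap : p.map f = q) (hker : p ⊓ LinearMap.ker f = p₀) {φ : V →ₗ[F] V}
    {ψ : W →ₗ[F] W} {c : F} (hcomm : f ∘ₗ φ = c • ψ ∘ₗ f) (hp : ∀ v ∈ p, φ v ∈ p)
    (hp₀ : ∀ v ∈ p₀, φ v ∈ p₀) (hq : ∀ w ∈ q, ψ w ∈ q) :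
    LinearMap.trace F p (φ.restrict hp) =
      LinearMap.trace F p₀ (φ.restrict hp₀) + c * LinearMap.trace F q (ψ.restrict hq) := by
  subst hmap hker
  have : FiniteDimensional F ↥(p ⊓ LinearMap.ker f) := Submodule.finiteDimensional_of_le inf_le_left
  rw [← smul_eq_mul c, ← map_smul]
  refine trace_eq_add_of_exact (i := Submodule.inclusion inf_le_left)
    (f := f.restrict fun _ => Submodule.mem_map_of_mem) (Submodule.inclusion_injective _) ?_ ?_ rfl
    (LinearMap.ext fun v => Subtype.ext (LinearMap.congr_fun hcomm v))
  · rintro ⟨_, v, hv, rfl⟩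
    exact ⟨⟨v, hv⟩, rfl⟩
  · rintro ⟨v, hv⟩
    simp [Subtype.ext_iff, hv]

end Trace

/-! ### Words -/

section Words

variable {n : ℕ}

theorem wordMonomial_cons (y : Fin n) (w : List (Fin n)) :
    wordMonomial (y :: w) = FreeAlgebra.ι ℚ y * wordMonomial w := by
  simp [wordMonomial]

theorem linearIndependent_wordMonomial :
    LinearIndependent ℚ (wordMonomial : List (Fin n) → FreeAlgebra ℚ (Fin n)) := by
  have h := (FreeAlgebra.basisFreeMonoid ℚ (Fin n)).linearIndependent
  simpa only [Function.comp_def, basisFreeMonoid_eq_wordMonomial, FreeMonoid.toList_ofList] using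
    h.comp FreeMonoid.ofList FreeMonoid.ofList.injective

theorem homogeneousPart_eq_span_wordMonomial (n k : ℕ) :
    (homogeneousPart n k).toSubmodule =
      Submodule.span ℚ (Set.range (wordMonomial ∘ List.ofFn : (Fin k → Fin n) → _)) := by
  refine (Submodule.span_pow _ k).trans (congrArg _ (Set.ext fun f => ?_))
  simp only [Set.mem_pow, Set.mem_range, Function.comp_apply, wordMonomial, List.map_ofFn]
  constructor
  · rintro ⟨w, rfl⟩
    choose v hv using fun i => (w i).2
    exact ⟨v, by simp [Function.comp_def, hv]⟩
  · rintro ⟨w, rfl⟩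
    exact ⟨fun i => ⟨_, w i, rfl⟩, rfl⟩

theorem glRep_diagGL_ι (a : Fin n → ℚˣ) (j : Fin n) :
    glRep n (diagGL a) (FreeAlgebra.ι ℚ j) = (a j : ℚ) • FreeAlgebra.ι ℚ j := by
  simp [glRep_ι, diagGL, Matrix.diagonal_apply, ite_smul]

theorem glRep_diagGL_wordMonomial (a : Fin n → ℚˣ) (w : List (Fin n)) :
    glRep n (diagGL a) (wordMonomial w) = (w.map fun i => (a i : ℚ)).prod • wordMonomial w := by
  induction w with
  | nil => simpa [wordMonomial] using glRep_algebraMap (diagGL a) 1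
  | cons y w ih =>
    rw [wordMonomial_cons, glRep_mul, ih, glRep_diagGL_ι, List.map_cons, List.prod_cons,
      smul_mul_smul_comm]

theorem trace_homogeneousPart (a : Fin n → ℚˣ) (k : ℕ) :
    LinearMap.trace ℚ _ ((glRep n (diagGL a)).restrict
      ((homogeneousPart n k).apply_mem_toSubmodule (diagGL a))) = (∑ i, (a i : ℚ)) ^ k := by
  have hli := linearIndependent_wordMonomial.comp _ (List.ofFn_injective (α := Fin n) (n := k))
  rw [trace_restrict_congr (homogeneousPart_eq_span_wordMonomial n k) _ _
      (homogeneousPart_eq_span_wordMonomial n k ▸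
        (homogeneousPart n k).apply_mem_toSubmodule (diagGL a)),
    trace_eq_sum_of_basis_eigenvectors (Module.Basis.span hli) (c := fun w => ∏ j, (a (w j) : ℚ)),
    Fintype.sum_pow]
  intro w
  apply Subtype.ext
  simp [Module.Basis.span_apply, glRep_diagGL_wordMonomial, List.prod_ofFn, List.map_ofFn]

end Words

/-! ### Constants of a set of Hausdorff derivatives -/

section Constants

variable {n : ℕ}

theorem hausdorffDerivative_comm (x y : Fin n) (f : FreeAlgebra ℚ (Fin n)) :
    hausdorffDerivative x (hausdorffDerivative y f) =
      hausdorffDerivative y (hausdorffDerivative x f) := by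
  induction f using FreeAlgebra.induction with
  | grade0 r => simp [Algebra.algebraMap_eq_smul_one, hausdorffDerivative_one]
  | grade1 z =>
    simp only [hausdorffDerivative_ι, apply_ite (hausdorffDerivative _), hausdorffDerivative_one,
      map_zero, ite_self]
  | mul f g hf hg =>
    simp only [hausdorffDerivative_mul, map_add, hf, hg]
    abel
  | add f g hf hg => rw [map_add, map_add, map_add, map_add, hf, hg]

theorem hausdorffDerivative_ι_pow_succ (x : Fin n) (j : ℕ) :
    hausdorffDerivative x (FreeAlgebra.ι ℚ x ^ (j + 1)) =
      ((j : ℚ) + 1) • FreeAlgebra.ι ℚ x ^ j := by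
  induction j with
  | zero => simp [hausdorffDerivative_ι]
  | succ j ih =>
    rw [pow_succ', hausdorffDerivative_ι_mul, ih, if_pos rfl, mul_smul_comm, ← pow_succ']
    push_cast
    module

theorem hausdorffDerivative_ι_pow_of_ne {x y : Fin n} (hxy : x ≠ y) (j : ℕ) :
    hausdorffDerivative y (FreeAlgebra.ι ℚ x ^ j) = 0 := by
  induction j with
  | zero => rw [pow_zero, hausdorffDerivative_one]
  | succ j ih => rw [pow_succ', hausdorffDerivative_ι_mul, ih, if_neg hxy, mul_zero, add_zero]

theorem hausdorffDerivative_eq_zero_of_mem_homogeneousPart_zero (x : Fin n)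
    {f : FreeAlgebra ℚ (Fin n)} (hf : f ∈ (homogeneousPart n 0).toSubmodule) :
    hausdorffDerivative x f = 0 := by
  obtain ⟨r, rfl⟩ := Submodule.mem_one.mp hf
  simp [Algebra.algebraMap_eq_smul_one, hausdorffDerivative_one]

theorem hausdorffDerivative_mem_homogeneousPart (x : Fin n) {k : ℕ} {f : FreeAlgebra ℚ (Fin n)}
    (hf : f ∈ (homogeneousPart n (k + 1)).toSubmodule) :
    hausdorffDerivative x f ∈ (homogeneousPart n k).toSubmodule := by
  set V := Submodule.span ℚ (Set.range (FreeAlgebra.ι ℚ : Fin n → FreeAlgebra ℚ (Fin n)))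
  have hV : V ≤ (1 : Submodule ℚ (FreeAlgebra ℚ (Fin n))).comap (hausdorffDerivative x) := by
    rw [Submodule.span_le]
    rintro _ ⟨y, rfl⟩
    rw [SetLike.mem_coe, Submodule.mem_comap, hausdorffDerivative_ι]
    split_ifs
    exacts [Submodule.one_le.mp le_rfl, zero_mem _]
  change hausdorffDerivative x f ∈ V ^ k
  replace hf : f ∈ V * V ^ k := (pow_succ' V k).le hf
  induction k generalizing f with
  | zero =>
    rw [pow_zero, mul_one] at hf
    rw [pow_zero]
    exact hV hf
  | succ k ih =>
    induction hf using Submodule.mul_induction_on' with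
    | mem_mul_mem v hv g hg =>
      rw [hausdorffDerivative_mul]
      rw [pow_succ'] at hg ⊢
      exact add_mem ((one_mul (V * V ^ k)).le (Submodule.mul_mem_mul (hV hv) hg))
        (Submodule.mul_mem_mul hv (ih hg))
    | add g _ h _ hg hh =>
      rw [map_add]
      exact add_mem hg hh

theorem mul_ι_pow_mem_homogeneousPart (x : Fin n) (j : ℕ) {k : ℕ} {f : FreeAlgebra ℚ (Fin n)}
    (hf : f ∈ (homogeneousPart n k).toSubmodule) :
    f * FreeAlgebra.ι ℚ x ^ j ∈ (homogeneousPart n (k + j)).toSubmodule := by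
  change _ ∈ Submodule.span ℚ (Set.range (FreeAlgebra.ι ℚ)) ^ (k + j)
  rw [pow_add]
  exact Submodule.mul_mem_mul hf
    (Submodule.pow_mem_pow _ (Submodule.subset_span (Set.mem_range_self x)) j)

/-- The homogeneous polynomials of degree `k` annihilated by `∂_x` for all `x ∈ S`: they
interpolate between all homogeneous polynomials (`S = ∅`) and the degree `k` part of `𝒜'_n`
(`S` the set of all variables). -/
def constantsPart (S : Finset (Fin n)) (k : ℕ) : Submodule ℚ (FreeAlgebra ℚ (Fin n)) :=
  (⨅ x ∈ S, LinearMap.ker (hausdorffDerivative x)) ⊓ (homogeneousPart n k).toSubmodule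

theorem mem_constantsPart {S : Finset (Fin n)} {k : ℕ} {f : FreeAlgebra ℚ (Fin n)} :
    f ∈ constantsPart S k ↔
      (∀ x ∈ S, hausdorffDerivative x f = 0) ∧ f ∈ (homogeneousPart n k).toSubmodule := by
  simp [constantsPart, Submodule.mem_inf, Submodule.mem_iInf]

theorem mem_constantsPart_insert {x : Fin n} {S : Finset (Fin n)} {k : ℕ}
    {f : FreeAlgebra ℚ (Fin n)} :
    f ∈ constantsPart (insert x S) k ↔ hausdorffDerivative x f = 0 ∧ f ∈ constantsPart S k := by
  simp only [mem_constantsPart, forall_mem_insert, and_assoc]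

instance (S : Finset (Fin n)) (k : ℕ) : Module.Finite ℚ (constantsPart S k) :=
  have : Module.Finite ℚ (homogeneousPart n k).toSubmodule :=
    .of_fg (.pow (Submodule.fg_span (Set.finite_range _)) k)
  Submodule.finiteDimensional_of_le (inf_le_right : constantsPart S k ≤ _)

theorem hausdorffDerivative_mem_constantsPart (x : Fin n) {S : Finset (Fin n)} {k : ℕ}
    {f : FreeAlgebra ℚ (Fin n)} (hf : f ∈ constantsPart S (k + 1)) :
    hausdorffDerivative x f ∈ constantsPart S k := by
  rw [mem_constantsPart] at hf ⊢
  exact ⟨fun y hy => by rw [hausdorffDerivative_comm, hf.1 y hy, map_zero],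
    hausdorffDerivative_mem_homogeneousPart x hf.2⟩

theorem mul_ι_pow_mem_constantsPart {x : Fin n} {S : Finset (Fin n)} (hx : x ∉ S) (j : ℕ) {k : ℕ}
    {f : FreeAlgebra ℚ (Fin n)} (hf : f ∈ constantsPart S k) :
    f * FreeAlgebra.ι ℚ x ^ j ∈ constantsPart S (k + j) := by
  rw [mem_constantsPart] at hf ⊢
  refine ⟨fun y hy => ?_, mul_ι_pow_mem_homogeneousPart x j hf.2⟩
  rw [hausdorffDerivative_mul, hf.1 y hy,
    hausdorffDerivative_ι_pow_of_ne (ne_of_mem_of_not_mem hy hx).symm, zero_mul, mul_zero, add_zero]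

/-- Integration by parts: `f x^j` is, up to the scalar `j + 1`, the difference of
`∂_x (f x^{j+1})` and `(∂_x f) x^{j+1}`, and `∂_x f` has smaller degree than `f`. -/
theorem exists_hausdorffDerivative_eq_mul_ι_pow {x : Fin n} {S : Finset (Fin n)} (hx : x ∉ S)
    {k : ℕ} {f : FreeAlgebra ℚ (Fin n)} (hf : f ∈ constantsPart S k) (j : ℕ) :
    ∃ g ∈ constantsPart S (k + j + 1), hausdorffDerivative x g = f * FreeAlgebra.ι ℚ x ^ j := by
  have hj : (j : ℚ) + 1 ≠ 0 := by positivity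
  obtain ⟨h, hh, hxh⟩ : ∃ h ∈ constantsPart S (k + j + 1),
      hausdorffDerivative x h = hausdorffDerivative x f * FreeAlgebra.ι ℚ x ^ (j + 1) := by
    match k with
    | 0 =>
      refine ⟨0, zero_mem _, ?_⟩
      rw [hausdorffDerivative_eq_zero_of_mem_homogeneousPart_zero x (mem_constantsPart.mp hf).2,
        map_zero, zero_mul]
    | k + 1 =>
      rw [add_assoc k, add_comm 1]
      exact exists_hausdorffDerivative_eq_mul_ι_pow hx (hausdorffDerivative_mem_constantsPart x hf)
        (j + 1)
  refine ⟨((j : ℚ) + 1)⁻¹ • (f * FreeAlgebra.ι ℚ x ^ (j + 1) - h),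
    Submodule.smul_mem _ _ (sub_mem (mul_ι_pow_mem_constantsPart hx (j + 1) hf) hh), ?_⟩
  rw [map_smul, map_sub, hausdorffDerivative_mul, hausdorffDerivative_ι_pow_succ, hxh,
    add_sub_cancel_left, mul_smul_comm, inv_smul_smul₀ hj]

theorem exists_mem_constantsPart_hausdorffDerivative_eq {x : Fin n} {S : Finset (Fin n)}
    (hx : x ∉ S) {k : ℕ} {f : FreeAlgebra ℚ (Fin n)} (hf : f ∈ constantsPart S k) :
    ∃ g ∈ constantsPart S (k + 1), hausdorffDerivative x g = f := by
  simpa using exists_hausdorffDerivative_eq_mul_ι_pow hx hf 0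

/-! ### Hilbert series of the constants -/

theorem hausdorffDerivative_glRep_diagGL (a : Fin n → ℚˣ) (x : Fin n) (f : FreeAlgebra ℚ (Fin n)) :
    hausdorffDerivative x (glRep n (diagGL a) f) =
      (a x : ℚ) • glRep n (diagGL a) (hausdorffDerivative x f) := by
  simp [hausdorffDerivative_glRep, diagGL, Matrix.diagonal_apply, ite_smul]

theorem glRep_diagGL_mem_constantsPart (a : Fin n → ℚˣ) (S : Finset (Fin n)) (k : ℕ) :
    ∀ f ∈ constantsPart S k, glRep n (diagGL a) f ∈ constantsPart S k := by
  intro f hf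
  rw [mem_constantsPart] at hf ⊢
  exact ⟨fun x hx => by rw [hausdorffDerivative_glRep_diagGL, hf.1 x hx, map_zero, smul_zero],
    (homogeneousPart n k).apply_mem_toSubmodule _ hf.2⟩

/-- The trace of `diag(a₁, …, a_n)` on `constantsPart S k`. -/
def constantsTrace (a : Fin n → ℚˣ) (S : Finset (Fin n)) (k : ℕ) : ℚ :=
  LinearMap.trace ℚ _ ((glRep n (diagGL a)).restrict (glRep_diagGL_mem_constantsPart a S k))

theorem constantsTrace_empty (a : Fin n → ℚˣ) (k : ℕ) :
    constantsTrace a ∅ k = (∑ i, (a i : ℚ)) ^ k :=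
  (trace_restrict_congr (by simp [constantsPart]) _ _ _).trans (trace_homogeneousPart a k)

theorem constantsTrace_univ (a : Fin n → ℚˣ) (k : ℕ) :
    constantsTrace a univ k =
      (derivedEnvelopingPart n k).toRepresentation.character (diagGL a) :=
  trace_restrict_congr (by simp [constantsPart, derivedEnvelopingPart, derivedEnveloping]) _ _
    ((derivedEnvelopingPart n k).apply_mem_toSubmodule (diagGL a))

theorem constantsTrace_insert_zero (a : Fin n → ℚˣ) (x : Fin n) (S : Finset (Fin n)) :
    constantsTrace a (insert x S) 0 = constantsTrace a S 0 := by
  refine trace_restrict_congr (Submodule.ext fun f => ?_) _ _ _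
  rw [mem_constantsPart_insert, and_iff_right_iff_imp]
  exact fun hf =>
    hausdorffDerivative_eq_zero_of_mem_homogeneousPart_zero x (mem_constantsPart.mp hf).2

theorem constantsTrace_insert_succ (a : Fin n → ℚˣ) {x : Fin n} {S : Finset (Fin n)} (hx : x ∉ S)
    (k : ℕ) : constantsTrace a (insert x S) (k + 1) =
      constantsTrace a S (k + 1) - a x * constantsTrace a S k := by
  have hmap : (constantsPart S (k + 1)).map (hausdorffDerivative x) = constantsPart S k :=
    le_antisymm (Submodule.map_le_iff_le_comap.mpr fun _ => hausdorffDerivative_mem_constantsPart x)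
      fun f hf => exists_mem_constantsPart_hausdorffDerivative_eq hx hf
  have hker : constantsPart S (k + 1) ⊓ LinearMap.ker (hausdorffDerivative x) =
      constantsPart (insert x S) (k + 1) :=
    Submodule.ext fun f => by rw [mem_constantsPart_insert, and_comm]; rfl
  have hcomm : hausdorffDerivative x ∘ₗ glRep n (diagGL a) =
      (a x : ℚ) • glRep n (diagGL a) ∘ₗ hausdorffDerivative x :=
    LinearMap.ext (hausdorffDerivative_glRep_diagGL a x)
  exact eq_sub_of_add_eq (trace_restrict_eq_add_of_map_eq hmap hker hcomm
    (glRep_diagGL_mem_constantsPart a S (k + 1)) (glRep_diagGL_mem_constantsPart a _ (k + 1))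
    (glRep_diagGL_mem_constantsPart a S k)).symm

theorem mk_constantsTrace_mul (a : Fin n → ℚˣ) (S : Finset (Fin n)) :
    PowerSeries.mk (constantsTrace a S) * (1 - PowerSeries.C (∑ i, (a i : ℚ)) * PowerSeries.X) =
      ∏ x ∈ S, (1 - PowerSeries.C (a x : ℚ) * PowerSeries.X) := by
  induction S using Finset.induction_on with
  | empty =>
    ext k
    rw [mul_sub, mul_one, ← mul_assoc, map_sub, PowerSeries.coeff_mk, constantsTrace_empty]
    rcases k with _ | k
    · simp
    · rw [PowerSeries.coeff_succ_mul_X, PowerSeries.coeff_mul_C, PowerSeries.coeff_mk,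
        constantsTrace_empty, pow_succ, sub_self, prod_empty, PowerSeries.coeff_one,
        if_neg k.succ_ne_zero]
  | insert x S hx ih =>
    have hinsert : PowerSeries.mk (constantsTrace a (insert x S)) =
        (1 - PowerSeries.C (a x : ℚ) * PowerSeries.X) * PowerSeries.mk (constantsTrace a S) := by
      ext k
      rcases k with _ | k
      · simp [constantsTrace_insert_zero]
      · simp [constantsTrace_insert_succ a hx, sub_mul, mul_assoc, PowerSeries.coeff_succ_X_mul]
    rw [prod_insert hx, hinsert, mul_assoc, ih]

theorem coeff_prod_one_sub_C_mul_X {σ R : Type*} [Fintype σ] [CommRing R] (a : σ → R) (k : ℕ) :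
    PowerSeries.coeff k (∏ i, (1 - PowerSeries.C (a i) * PowerSeries.X)) =
      (-1) ^ k * eval a (esymm σ R k) := by
  have haeval (j : ℕ) : aeval (fun i => PowerSeries.C (a i) * PowerSeries.X)
      (esymm σ R j) =
        PowerSeries.C (eval a (esymm σ R j)) * PowerSeries.X ^ j := by
    simp only [esymm, map_sum, map_prod, aeval_X, eval_X,
      prod_mul_distrib, prod_const, sum_mul]
    exact sum_congr rfl fun S hS => by rw [(mem_powersetCard.mp hS).2]
  have hcoeff (j : ℕ) : PowerSeries.coeff k
      ((-1) ^ j * (PowerSeries.C (eval a (esymm σ R j)) *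
        PowerSeries.X ^ j)) =
      if k = j then (-1) ^ j * eval a (esymm σ R j) else 0 := by
    rw [← mul_assoc, ← PowerSeries.coeff_C_mul_X_pow]
    simp
  rw [prod_one_sub_eq_sum_aeval_esymm (R := R), map_sum]
  simp only [haeval, hcoeff, sum_ite_eq, mem_range, ite_eq_left_iff, not_lt]
  intro hk
  rw [esymm_eq_zero_of_card_lt hk, map_zero, mul_zero]

theorem constantsTrace_univ_eq_eval_alternatingHookSum (a : Fin n → ℚˣ) (k : ℕ) :
    constantsTrace a univ k =
      eval (fun i => (a i : ℚ)) (alternatingHookSum (Fin n) ℚ k) := by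
  have hcoeff := fun k => congrArg (PowerSeries.coeff k) (mk_constantsTrace_mul a univ)
  simp only [coeff_prod_one_sub_C_mul_X] at hcoeff
  induction k with
  | zero => simpa [alternatingHookSum_zero] using hcoeff 0
  | succ k ih =>
    have h := hcoeff (k + 1)
    rw [mul_sub, mul_one, ← mul_assoc, map_sub, PowerSeries.coeff_succ_mul_X,
      PowerSeries.coeff_mul_C, PowerSeries.coeff_mk, PowerSeries.coeff_mk, ih] at h
    simp only [alternatingHookSum_succ, map_add, map_mul, map_sum, map_pow, map_neg, map_one,
      eval_X]
    linear_combination h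

theorem isCharacterDerivedEnveloping (n : ℕ) :
    IsCharacterDerivedEnveloping n
      ((∏ i, (1 - MvPowerSeries.X i)) * (1 - ∑ i, MvPowerSeries.X i)⁻¹) :=
  ⟨alternatingHookSum (Fin n) ℚ,
    fun k a => by rw [← constantsTrace_univ, constantsTrace_univ_eq_eval_alternatingHookSum],
    hasSum_alternatingHookSum⟩

end Constants

/-! ### Alternants and Schur polynomials -/

theorem homogeneousComponent_add_mul {σ R : Type*} [CommSemiring R] {p : MvPolynomial σ R} {k : ℕ}
    (hp : p.IsHomogeneous k) (q : MvPolynomial σ R) (d : ℕ) :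
    homogeneousComponent (k + d) (p * q) = p * homogeneousComponent d q := by
  let _ : GradedRing (homogeneousSubmodule σ R) := gradedAlgebra
  rw [← decomposition.decompose'_apply, ← decomposition.decompose'_apply]
  exact DirectSum.coe_decompose_mul_add_of_left_mem (homogeneousSubmodule σ R) hp

theorem isHomogeneous_of_isHomogeneous_mul {σ R : Type*} [CommRing R] [IsDomain R]
    {p q : MvPolynomial σ R} {k d : ℕ} (hp₀ : p ≠ 0) (hp : p.IsHomogeneous k)
    (hpq : (p * q).IsHomogeneous (k + d)) : q.IsHomogeneous d := by
  have h : p * homogeneousComponent d q = p * q := by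
    rw [← homogeneousComponent_add_mul hp, homogeneousComponent_eq_self hpq]
  rw [← mul_left_cancel₀ hp₀ h]
  exact homogeneousComponent_isHomogeneous d q

section Alternant

variable {n : ℕ}

theorem alternant_eq_zero_of_apply_eq {f : Fin n → ℕ} {i j : Fin n} (hij : i ≠ j) (h : f i = f j) :
    alternant f = 0 :=
  Matrix.det_zero_of_column_eq hij fun k => by rw [Matrix.of_apply, Matrix.of_apply, h]

theorem alternant_mul_esymm (f : Fin n → ℕ) (k : ℕ) :
    alternant f * esymm (Fin n) ℚ k =
      ∑ S ∈ powersetCard k univ, alternant fun j => f j + if j ∈ S then 1 else 0 := by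
  have hesymm (σ : Equiv.Perm (Fin n)) :
      esymm (Fin n) ℚ k = ∑ S ∈ powersetCard k univ, ∏ j ∈ S, X (σ j) := by
    conv_lhs => rw [← esymm_isSymmetric (Fin n) ℚ k σ]
    simp only [esymm, map_sum, map_prod, rename_X]
  simp only [alternant, Matrix.det_apply, Matrix.of_apply]
  rw [sum_comm, sum_mul]
  refine sum_congr rfl fun σ _ => ?_
  rw [← smul_sum, smul_mul_assoc, hesymm σ, mul_sum]
  simp only [pow_add, prod_mul_distrib, pow_ite, pow_one, pow_zero, prod_ite_mem, univ_inter]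

theorem alternant_mul_sum_X (f : Fin n → ℕ) :
    alternant f * ∑ i, X i = ∑ r, alternant fun j => f j + if j = r then 1 else 0 := by
  rw [← esymm_one, alternant_mul_esymm, powersetCard_one, sum_map]
  simp only [Function.Embedding.coeFn_mk, mem_singleton]

theorem isHomogeneous_alternant (f : Fin n → ℕ) : (alternant f).IsHomogeneous (∑ j, f j) := by
  rw [alternant, Matrix.det_apply']
  refine IsHomogeneous.sum _ _ _ fun σ _ => ?_
  have hprod : (∏ j, (X (σ j) : MvPolynomial (Fin n) ℚ) ^ f j).IsHomogeneous (∑ j, f j) :=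
    IsHomogeneous.prod _ _ _ fun j _ => isHomogeneous_X_pow _ _
  simpa using hprod.C_mul ((Equiv.Perm.sign σ : ℤ) : ℚ)

theorem schurPoly_eq_zero {μ : YoungDiagram} (h : n < μ.colLen 0) : schurPoly n μ = 0 :=
  if_neg h.not_ge

theorem sum_rowLen {μ : YoungDiagram} (h : μ.colLen 0 ≤ n) :
    ∑ j : Fin n, μ.rowLen j = μ.card := by
  have hmaps : Set.MapsTo Prod.fst (μ.cells : Set (ℕ × ℕ)) (range n) := fun c hc =>
    mem_coe.mpr <| mem_range.mpr <|
      (YoungDiagram.mem_iff_lt_colLen.mp (μ.up_left_mem le_rfl (Nat.zero_le c.2) hc)).trans_le h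
  rw [Fin.sum_univ_eq_sum_range μ.rowLen n, YoungDiagram.card, card_eq_sum_card_fiberwise hmaps]
  exact sum_congr rfl fun i _ => μ.rowLen_eq_card

theorem isHomogeneous_schurPoly (n : ℕ) (μ : YoungDiagram) :
    (schurPoly n μ).IsHomogeneous μ.card := by
  rcases lt_or_ge n (μ.colLen 0) with h | h
  · rw [schurPoly_eq_zero h]
    exact isHomogeneous_zero _ _ _
  · refine isHomogeneous_of_isHomogeneous_mul (alternant_staircase_ne_zero n)
      (isHomogeneous_alternant _) ?_
    rw [alternant_staircase_mul_schurPoly h, ← sum_rowLen h, add_comm, ← sum_add_distrib]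
    exact isHomogeneous_alternant _

end Alternant

/-! ### Adding a cell to a Young diagram -/

/-- The rows of `μ` at the end of which a cell can be added. -/
def addableRows (μ : YoungDiagram) : Finset ℕ :=
  {r ∈ range (μ.colLen 0 + 1) | ∀ i < r, μ.rowLen r < μ.rowLen i}

/-- The smallest Young diagram which contains `μ` and the first cell beyond row `r`. If `r` is an
addable row, this is `μ` with one more cell in row `r`. -/
def addCell (μ : YoungDiagram) (r : ℕ) : YoungDiagram :=
  μ ⊔ ⟨Iic (r, μ.rowLen r), by rw [coe_Iic]; exact isLowerSet_Iic _⟩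

section AddCell

variable {μ : YoungDiagram} {r : ℕ}

theorem rowLen_eq_zero_iff : μ.rowLen r = 0 ↔ μ.colLen 0 ≤ r := by
  rw [← not_lt, ← YoungDiagram.mem_iff_lt_colLen, YoungDiagram.mem_iff_lt_rowLen, not_lt,
    nonpos_iff_eq_zero]

theorem mk_rowLen_notMem : (r, μ.rowLen r) ∉ μ := by
  simp [YoungDiagram.mem_iff_lt_rowLen]

theorem mem_addableRows : r ∈ addableRows μ ↔ ∀ i < r, μ.rowLen r < μ.rowLen i := by
  rw [addableRows, mem_filter, and_iff_right_iff_imp, mem_range, Nat.lt_succ_iff]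
  refine fun h => not_lt.mp fun hr => ?_
  have := h _ hr
  rw [rowLen_eq_zero_iff.mpr le_rfl] at this
  exact Nat.not_lt_zero _ this

theorem le_colLen_of_mem_addableRows (hr : r ∈ addableRows μ) : r ≤ μ.colLen 0 :=
  Nat.lt_succ_iff.mp (mem_range.mp (mem_filter.mp hr).1)

theorem colLen_mem_addableRows (μ : YoungDiagram) : μ.colLen 0 ∈ addableRows μ := by
  refine mem_addableRows.mpr fun i hi => ?_
  rwa [rowLen_eq_zero_iff.mpr le_rfl, pos_iff_ne_zero, ne_eq, rowLen_eq_zero_iff, not_le]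

theorem mem_addCell_iff_le {c : ℕ × ℕ} : c ∈ addCell μ r ↔ c ∈ μ ∨ c ≤ (r, μ.rowLen r) :=
  mem_union.trans (or_congr_right mem_Iic)

theorem mem_addCell (hr : r ∈ addableRows μ) {c : ℕ × ℕ} :
    c ∈ addCell μ r ↔ c = (r, μ.rowLen r) ∨ c ∈ μ := by
  obtain ⟨i, j⟩ := c
  rw [mem_addCell_iff_le, Prod.mk_le_mk, YoungDiagram.mem_iff_lt_rowLen, Prod.mk.injEq]
  rcases lt_trichotomy i r with hi | rfl | hi
  · have := mem_addableRows.mp hr i hi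
    omega
  · omega
  · omega

theorem cells_addCell (hr : r ∈ addableRows μ) :
    (addCell μ r).cells = insert (r, μ.rowLen r) μ.cells := by
  ext c
  rw [YoungDiagram.mem_cells, mem_addCell hr, mem_insert, YoungDiagram.mem_cells]

theorem card_addCell (hr : r ∈ addableRows μ) : (addCell μ r).card = μ.card + 1 := by
  rw [YoungDiagram.card, cells_addCell hr, card_insert_of_notMem mk_rowLen_notMem]

theorem rowLen_addCell (hr : r ∈ addableRows μ) (i : ℕ) :
    (addCell μ r).rowLen i = μ.rowLen i + if i = r then 1 else 0 := by
  refine eq_of_forall_lt_iff fun j => ?_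
  rw [← YoungDiagram.mem_iff_lt_rowLen, mem_addCell hr, YoungDiagram.mem_iff_lt_rowLen,
    Prod.mk.injEq]
  split_ifs with hi
  · subst hi
    omega
  · simp [hi]

theorem colLen_zero_addCell (μ : YoungDiagram) (r : ℕ) :
    (addCell μ r).colLen 0 = max (μ.colLen 0) (r + 1) := by
  refine eq_of_forall_lt_iff fun i => ?_
  rw [← YoungDiagram.mem_iff_lt_colLen, mem_addCell_iff_le, YoungDiagram.mem_iff_lt_colLen,
    Prod.mk_le_mk, and_iff_left (Nat.zero_le _), lt_max_iff, Nat.lt_succ_iff]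

theorem mem_addableRows_of_cells_eq_insert {ν : YoungDiagram} {c : ℕ × ℕ} (hc : c ∉ μ)
    (hν : ν.cells = insert c μ.cells) :
    c.1 ∈ addableRows μ ∧ c.2 = μ.rowLen c.1 ∧ ν = addCell μ c.1 := by
  have hmem (d : ℕ × ℕ) : d ∈ ν ↔ d = c ∨ d ∈ μ := by
    rw [← YoungDiagram.mem_cells, hν, mem_insert, YoungDiagram.mem_cells]
  have hlt {d : ℕ × ℕ} (hd : d < c) : d ∈ μ :=
    ((hmem d).mp (ν.isLowerSet hd.le ((hmem c).mpr (.inl rfl)))).resolve_left hd.ne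
  obtain ⟨r, j⟩ := c
  have hj : j = μ.rowLen r := by
    rw [YoungDiagram.mem_iff_lt_rowLen, not_lt] at hc
    refine le_antisymm (not_lt.mp fun h => ?_) hc
    exact mk_rowLen_notMem (hlt (Prod.mk_lt_mk.mpr (.inr ⟨le_rfl, h⟩)))
  subst hj
  have hr : r ∈ addableRows μ := mem_addableRows.mpr fun i hi =>
    YoungDiagram.mem_iff_lt_rowLen.mp (hlt (Prod.mk_lt_mk.mpr (.inl ⟨hi, le_rfl⟩)))
  exact ⟨hr, rfl, YoungDiagram.ext (hν.trans (cells_addCell hr).symm)⟩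

end AddCell

/-! ### The Pieri rule for `e₁` -/

theorem alternant_eq_zero_of_notMem_addableRows {n : ℕ} {μ : YoungDiagram} {r : Fin n}
    (hr : (r : ℕ) ∉ addableRows μ) :
    alternant (fun j => μ.rowLen j + staircase n j + if j = r then 1 else 0) = 0 := by
  rw [mem_addableRows] at hr
  push Not at hr
  obtain ⟨i, hir, hi⟩ := hr
  have hrow : μ.rowLen (r - 1) = μ.rowLen r :=
    le_antisymm ((μ.rowLen_anti i _ (by omega)).trans hi) (μ.rowLen_anti _ _ (by omega))
  have hne : (⟨r - 1, by omega⟩ : Fin n) ≠ r := fun h => by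
    have := congrArg Fin.val h
    simp only at this
    omega
  refine alternant_eq_zero_of_apply_eq hne ?_
  simp only [if_neg hne, if_true, staircase, hrow]
  omega

theorem schurPoly_mul_sum_X (n : ℕ) (μ : YoungDiagram) :
    schurPoly n μ * ∑ i, X i = ∑ r ∈ addableRows μ, schurPoly n (addCell μ r) := by
  rcases lt_or_ge n (μ.colLen 0) with h | h
  · rw [schurPoly_eq_zero h, zero_mul, sum_eq_zero]
    exact fun r _ => schurPoly_eq_zero (by rw [colLen_zero_addCell]; exact lt_max_of_lt_left h)
  have hterm (r : Fin n) :
      alternant (fun j => μ.rowLen j + staircase n j + if j = r then 1 else 0) =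
        if (r : ℕ) ∈ addableRows μ then alternant (staircase n) * schurPoly n (addCell μ r)
        else 0 := by
    split_ifs with hr
    · rw [alternant_staircase_mul_schurPoly (by rw [colLen_zero_addCell]; exact max_le h r.2)]
      simp only [rowLen_addCell hr, Fin.ext_iff, add_right_comm]
    · exact alternant_eq_zero_of_notMem_addableRows hr
  apply mul_left_cancel₀ (alternant_staircase_ne_zero n)
  rw [← mul_assoc, alternant_staircase_mul_schurPoly h, alternant_mul_sum_X, mul_sum,
    sum_congr rfl fun r _ => hterm r, Fin.sum_univ_eq_sum_range (fun r => if r ∈ addableRows μ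
      then alternant (staircase n) * schurPoly n (addCell μ r) else 0) n, ← sum_filter]
  refine sum_subset (fun r hr => (mem_filter.mp hr).2) fun r hr hrn => ?_
  have hnr : n ≤ r := not_lt.mp fun hlt => hrn (mem_filter.mpr ⟨mem_range.mpr hlt, hr⟩)
  rw [schurPoly_eq_zero, mul_zero]
  rw [colLen_zero_addCell]
  exact lt_max_of_lt_right (Nat.lt_succ_of_le hnr)

/-! ### Columns -/

/-- The Young diagram `(1^k)`, a single column with `k` cells. -/
def column (k : ℕ) : YoungDiagram where
  cells := range k ×ˢ range 1
  isLowerSet := by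
    rintro ⟨i, j⟩ ⟨i', j'⟩ ⟨hi, hj⟩ hc
    simp only [coe_product, Set.mem_prod, mem_coe, mem_range] at hc ⊢
    exact ⟨hi.trans_lt hc.1, hj.trans_lt hc.2⟩

section Column

variable {k : ℕ}

theorem mem_column {c : ℕ × ℕ} : c ∈ column k ↔ c.1 < k ∧ c.2 = 0 := by
  rw [← YoungDiagram.mem_cells, column, mem_product, mem_range, mem_range, Nat.lt_one_iff]

theorem rowLen_column (k i : ℕ) : (column k).rowLen i = if i < k then 1 else 0 := by
  refine eq_of_forall_lt_iff fun j => ?_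
  rw [← YoungDiagram.mem_iff_lt_rowLen, mem_column]
  split_ifs with h <;> simp [h]

theorem colLen_zero_column (k : ℕ) : (column k).colLen 0 = k := by
  refine eq_of_forall_lt_iff fun i => ?_
  rw [← YoungDiagram.mem_iff_lt_colLen, mem_column, and_iff_left rfl]

theorem addCell_column (k : ℕ) : addCell (column k) k = column (k + 1) := by
  have hk : k ∈ addableRows (column k) := by
    simpa only [colLen_zero_column] using colLen_mem_addableRows (column k)
  ext ⟨i, j⟩
  rw [YoungDiagram.mem_cells, YoungDiagram.mem_cells, mem_addCell hk, mem_column, mem_column,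
    rowLen_column, if_neg (lt_irrefl k), Prod.mk.injEq]
  omega

theorem eq_filter_val_lt_card_of_pred_mem {n : ℕ} {S : Finset (Fin n)}
    (hS : ∀ i j : Fin n, (j : ℕ) = i + 1 → j ∈ S → i ∈ S) :
    S = univ.filter fun j : Fin n => (j : ℕ) < #S := by
  have hlower (i : Fin n) (j : ℕ) (hij : (i : ℕ) ≤ j) : ∀ hj : j < n, ⟨j, hj⟩ ∈ S → i ∈ S := by
    induction j, hij using Nat.le_induction with
    | base => exact fun _ hi => hi
    | succ j _ ih => exact fun hj hjS => ih (Nat.lt_of_succ_lt hj) (hS _ _ rfl hjS)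
  refine eq_of_subset_of_card_le (fun j hj => ?_) ?_
  · have hIic : Iic j ⊆ S := fun i hi => hlower i j (Fin.le_def.mp (mem_Iic.mp hi)) j.2 hj
    have hcard := card_le_card hIic
    rw [Fin.card_Iic] at hcard
    exact mem_filter.mpr ⟨mem_univ j, hcard⟩
  · rw [Fin.card_filter_val_lt]
    exact min_le_right _ _

theorem schurPoly_column (n k : ℕ) : schurPoly n (column k) = esymm (Fin n) ℚ k := by
  rcases lt_or_ge n k with h | h
  · rw [schurPoly_eq_zero (by rwa [colLen_zero_column]),
      esymm_eq_zero_of_card_lt (by rwa [Fintype.card_fin])]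
  apply mul_left_cancel₀ (alternant_staircase_ne_zero n)
  rw [alternant_staircase_mul_schurPoly (by rwa [colLen_zero_column]), alternant_mul_esymm,
    sum_eq_single (univ.filter fun j : Fin n => (j : ℕ) < k)]
  · simp only [rowLen_column, mem_filter_univ, add_comm]
  · intro S hS hne
    have hcard := (mem_powersetCard.mp hS).2
    have hgap : ¬∀ i j : Fin n, (j : ℕ) = i + 1 → j ∈ S → i ∈ S := fun hpred =>
      hne (hcard ▸ eq_filter_val_lt_card_of_pred_mem hpred)
    push Not at hgap
    obtain ⟨i, j, hij, hj, hi⟩ := hgap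
    refine alternant_eq_zero_of_apply_eq (ne_of_mem_of_not_mem hj hi).symm ?_
    have := j.2
    rw [if_neg hi, if_pos hj, staircase, staircase]
    omega
  · refine fun hk => absurd (mem_powersetCard.mpr ⟨subset_univ _, ?_⟩) hk
    rw [Fin.card_filter_val_lt, min_eq_right h]

end Column

/-! ### Adding a cell to a standard tableau -/

namespace StandardTableau

variable {μ : YoungDiagram}

theorem sigma_ext {T U : Σ μ, StandardTableau μ}
    (h : ∀ i j, T.2.entry i j = U.2.entry i j) : T = U := by
  have hmem (T : Σ μ, StandardTableau μ) (i j : ℕ) : (i, j) ∈ T.1 ↔ T.2.entry i j ≠ 0 :=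
    ⟨fun hc => Nat.one_le_iff_ne_zero.mp (T.2.bijOn.mapsTo hc).1,
      fun hc => by_contra fun hc' => hc (T.2.zeros hc')⟩
  have hshape : T.1 = U.1 := by
    ext ⟨i, j⟩
    rw [YoungDiagram.mem_cells, YoungDiagram.mem_cells, hmem, hmem, h]
  obtain ⟨μ, t, _, _, _, _⟩ := T
  obtain ⟨ν, u, _, _, _, _⟩ := U
  obtain rfl : μ = ν := hshape
  obtain rfl : t = u := funext₂ h
  rfl

theorem entry_le (T : StandardTableau μ) (i j : ℕ) : T.entry i j ≤ μ.card := by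
  by_cases h : (i, j) ∈ μ
  · exact (T.bijOn.mapsTo h).2
  · rw [T.zeros h]
    exact Nat.zero_le _

theorem entry_lt_of_lt (T : StandardTableau μ) {c d : ℕ × ℕ} (hdc : d < c) (hc : c ∈ μ) :
    T.entry d.1 d.2 < T.entry c.1 c.2 := by
  obtain ⟨i, j⟩ := d
  obtain ⟨i', j'⟩ := c
  obtain ⟨hi, hj⟩ | ⟨hi, hj⟩ := Prod.mk_lt_mk.mp hdc
  · rcases hj.eq_or_lt with rfl | hj
    · exact T.col_strict hi hc
    · exact (T.row_strict hj (μ.up_left_mem hi.le le_rfl hc)).trans (T.col_strict hi hc)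
  · rcases hi.eq_or_lt with rfl | hi
    · exact T.row_strict hj hc
    · exact (T.row_strict hj (μ.up_left_mem hi.le le_rfl hc)).trans (T.col_strict hi hc)

/-- The standard tableau with entries `f`, where `f` increases along the product order on cells. -/
def ofLT (f : ℕ × ℕ → ℕ) (hlt : ∀ {c d}, d < c → c ∈ μ → f d < f c)
    (hbij : Set.BijOn f μ.cells (Set.Icc 1 μ.card)) (hzero : ∀ c ∉ μ, f c = 0) :
    StandardTableau μ where
  entry i j := f (i, j)
  row_strict hj hc := hlt (Prod.mk_lt_mk_iff_right.mpr hj) hc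
  col_strict hi hc := hlt (Prod.mk_lt_mk_iff_left.mpr hi) hc
  bijOn := hbij
  zeros hc := hzero _ hc

section Add

variable {r : ℕ}

/-- The tableau obtained from `T` by adding a cell with the largest entry at the end of row `r`. -/
def add (T : StandardTableau μ) (hr : r ∈ addableRows μ) : StandardTableau (addCell μ r) :=
  ofLT (fun c => if c = (r, μ.rowLen r) then μ.card + 1 else T.entry c.1 c.2)
    (fun {c d} hdc hc => by
      rcases (mem_addCell hr).mp hc with rfl | hc
      · rw [if_pos rfl, if_neg hdc.ne]
        exact Nat.lt_succ_of_le (T.entry_le _ _)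
      · have hd : d ∈ μ := μ.isLowerSet hdc.le hc
        rw [if_neg (ne_of_mem_of_not_mem hc mk_rowLen_notMem),
          if_neg (ne_of_mem_of_not_mem hd mk_rowLen_notMem)]
        exact T.entry_lt_of_lt hdc hc)
    (by
      have hold : Set.BijOn (fun c => if c = (r, μ.rowLen r) then μ.card + 1
          else T.entry c.1 c.2) μ.cells (Set.Icc 1 μ.card) := T.bijOn.congr fun c hc =>
        (if_neg (ne_of_mem_of_not_mem (show c ∈ μ from hc) mk_rowLen_notMem)).symm
      have hnew := hold.insert (a := (r, μ.rowLen r)) (by simp)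
      rw [if_pos rfl, ← coe_insert, ← cells_addCell hr,
        Set.insert_Icc_right_eq_Icc_add_one (Nat.le_add_left 1 _)] at hnew
      rwa [card_addCell hr])
    (fun c hc => by
      rw [mem_addCell hr, not_or] at hc
      rw [if_neg hc.1, T.zeros hc.2])

theorem add_entry (T : StandardTableau μ) (hr : r ∈ addableRows μ) (i j : ℕ) :
    (T.add hr).entry i j = if (i, j) = (r, μ.rowLen r) then μ.card + 1 else T.entry i j :=
  rfl

theorem add_entry_eq_card_add_one_iff (T : StandardTableau μ) (hr : r ∈ addableRows μ) {i j : ℕ} :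
    (T.add hr).entry i j = μ.card + 1 ↔ (i, j) = (r, μ.rowLen r) := by
  rw [add_entry]
  split_ifs with h
  · exact iff_of_true rfl h
  · exact iff_of_false (Nat.lt_succ_of_le (T.entry_le i j)).ne h

theorem entry_eq_ite_add_entry (T : StandardTableau μ) (hr : r ∈ addableRows μ) (i j : ℕ) :
    T.entry i j =
      if (T.add hr).entry i j = μ.card + 1 then 0 else (T.add hr).entry i j := by
  simp only [T.add_entry_eq_card_add_one_iff hr]
  split_ifs with h
  · exact T.zeros (h ▸ mk_rowLen_notMem)
  · rw [add_entry, if_neg h]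

end Add

theorem exists_add_eq {ν : YoungDiagram} (U : StandardTableau ν) (hν : ν.card ≠ 0) :
    ∃ (μ : YoungDiagram) (T : StandardTableau μ) (r : ℕ) (hr : r ∈ addableRows μ),
      (⟨addCell μ r, T.add hr⟩ : Σ μ, StandardTableau μ) = ⟨ν, U⟩ := by
  obtain ⟨c, hc, hmax⟩ := U.bijOn.surjOn ⟨Nat.one_le_iff_ne_zero.mpr hν, le_rfl⟩
  let μ : YoungDiagram :=
    { cells := ν.cells.erase c
      isLowerSet := fun e d hde he => by
        rw [mem_coe, mem_erase] at he ⊢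
        refine ⟨?_, ν.isLowerSet hde he.2⟩
        rintro rfl
        have := U.entry_lt_of_lt (hde.lt_of_ne he.1.symm) he.2
        exact (hmax.symm.trans_lt this).not_ge (U.entry_le _ _) }
  have hμ {d : ℕ × ℕ} : d ∈ μ ↔ d ≠ c ∧ d ∈ ν := mem_erase
  have hcard : ν.card = μ.card + 1 := (card_erase_add_one hc).symm
  let T : StandardTableau μ := ofLT (fun d => if d = c then 0 else U.entry d.1 d.2)
    (fun {e d} hde he => by
      rw [if_neg (hμ.mp he).1, if_neg (hμ.mp (μ.isLowerSet hde.le he)).1]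
      exact U.entry_lt_of_lt hde (hμ.mp he).2)
    (by
      have hbij := U.bijOn.sdiff_singleton hc
      rw [show U.entry c.1 c.2 = ν.card from hmax, hcard, ← coe_erase, Set.Icc_sdiff_right,
        ← Order.succ_eq_add_one, Order.Ico_succ_right] at hbij
      exact hbij.congr fun d hd => (if_neg (hμ.mp hd).1).symm)
    (fun d hd => by
      by_cases hdc : d = c
      · exact if_pos hdc
      · rw [if_neg hdc, U.zeros fun hdν => hd (hμ.mpr ⟨hdc, hdν⟩)])
  obtain ⟨hr, hcol, -⟩ := mem_addableRows_of_cells_eq_insert (μ := μ) (notMem_erase c _)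
    (insert_erase hc).symm
  refine ⟨μ, T, c.1, hr, sigma_ext fun i j => ?_⟩
  change (if (i, j) = (c.1, μ.rowLen c.1) then μ.card + 1 else
    if (i, j) = c then 0 else U.entry i j) = U.entry i j
  rw [← hcol, Prod.mk.eta]
  split_ifs with hij
  · rw [← hcard, ← hmax, ← hij]
  · rfl

/-! ### The first missing entry of the first column -/

/-- The positive integers which do not appear in the first column of `T`. Cells outside `μ` need
not be excluded, since they have entry `0`. -/
def missing (T : StandardTableau μ) : Set ℕ :=
  {m | m ≠ 0 ∧ ∀ i, T.entry i 0 ≠ m}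

theorem firstMissing_eq_sInf_missing (T : StandardTableau μ) :
    T.firstMissing = sInf T.missing := by
  refine congrArg sInf (Set.ext fun m => ?_)
  refine (and_congr_left' Nat.one_le_iff_ne_zero).trans (and_congr_right fun hm => ?_)
  refine forall_congr' fun i => ⟨fun h hi => ?_, fun h _ => h⟩
  by_cases hc : (i, 0) ∈ μ
  · exact h hc hi
  · exact hm (hi ▸ T.zeros hc)

theorem mem_missing_of_card_lt (T : StandardTableau μ) {m : ℕ} (hm : μ.card < m) :
    m ∈ T.missing :=
  ⟨Nat.ne_zero_of_lt hm, fun i => ((T.entry_le i 0).trans_lt hm).ne⟩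

theorem isLeast_firstMissing (T : StandardTableau μ) : IsLeast T.missing T.firstMissing := by
  rw [firstMissing_eq_sInf_missing]
  exact ⟨Nat.sInf_mem ⟨_, T.mem_missing_of_card_lt (Nat.lt_succ_self _)⟩, fun _ => Nat.sInf_le⟩

theorem firstMissing_eq_iff {T : StandardTableau μ} {m : ℕ} :
    T.firstMissing = m ↔ IsLeast T.missing m :=
  ⟨fun h => h ▸ T.isLeast_firstMissing, fun h => T.isLeast_firstMissing.unique h⟩

variable {r : ℕ}

theorem missing_add (T : StandardTableau μ) (hr : r ∈ addableRows μ) :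
    (T.add hr).missing = if r = μ.colLen 0 then T.missing \ {μ.card + 1} else T.missing := by
  have hcol : μ.rowLen r = 0 ↔ r = μ.colLen 0 := rowLen_eq_zero_iff.trans
    ⟨(le_colLen_of_mem_addableRows hr).antisymm, Eq.ge⟩
  ext m
  split_ifs with hr₀ <;> rw [← hcol] at hr₀
  · have hold : T.entry r 0 = 0 := T.zeros (hr₀ ▸ mk_rowLen_notMem)
    simp only [missing, Set.mem_ofPred_eq, Set.mem_sdiff, Set.mem_singleton_iff, add_entry, hr₀,
      Prod.mk.injEq, and_true]
    grind
  · simp only [missing, Set.mem_ofPred_eq, add_entry, Prod.mk.injEq, Ne.symm hr₀, and_false,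
      if_false]

theorem firstMissing_add (T : StandardTableau μ) (hr : r ∈ addableRows μ) :
    (T.add hr).firstMissing =
      if T.firstMissing = μ.card + 1 ∧ r = μ.colLen 0 then μ.card + 2 else T.firstMissing := by
  obtain ⟨hmem, hle⟩ := T.isLeast_firstMissing
  rw [firstMissing_eq_iff, missing_add]
  split_ifs with hcol hfirst hfirst
  · refine ⟨⟨T.mem_missing_of_card_lt (by lia), by simp⟩, fun l hl => ?_⟩
    have := hle hl.1
    have : l ≠ μ.card + 1 := hl.2
    lia
  · exact ⟨⟨hmem, fun h => hfirst ⟨h, hcol⟩⟩, fun l hl => hle hl.1⟩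
  · exact absurd hfirst.2 hcol
  · exact ⟨hmem, hle⟩

theorem firstMissing_le (T : StandardTableau μ) : T.firstMissing ≤ μ.card + 1 :=
  T.isLeast_firstMissing.2 (T.mem_missing_of_card_lt (Nat.lt_succ_self _))

theorem firstMissing_add_eq_card_add_two_iff (T : StandardTableau μ) (hr : r ∈ addableRows μ) :
    (T.add hr).firstMissing = μ.card + 2 ↔ T.firstMissing = μ.card + 1 ∧ r = μ.colLen 0 := by
  have := T.firstMissing_le
  rw [firstMissing_add]
  split_ifs with h <;> lia

end StandardTableau

/-! ### The sum over tableaux -/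

theorem hasSum_of_hasSum_fiber_of_isHomogeneous {ι σ R : Type*} [CommSemiring R]
    [TopologicalSpace R] [T2Space R] {p : ι → MvPolynomial σ R} {d : ι → ℕ}
    [∀ k, Fintype {i // d i = k}] (hp : ∀ i, (p i).IsHomogeneous (d i)) {s : MvPowerSeries σ R}
    (hs : HasSum
      (fun k => ((∑ i : {i // d i = k}, p i : MvPolynomial σ R) : MvPowerSeries σ R)) s) :
    HasSum (fun i => (p i : MvPowerSeries σ R)) s := by
  rw [MvPowerSeries.WithPiTopology.hasSum_iff_hasSum_coeff] at hs ⊢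
  intro m
  simp only [MvPolynomial.coeff_coe] at hs ⊢
  have hfiber (k : ℕ) (hk : k ≠ m.degree) : coeff m (∑ i : {i // d i = k}, p i) = 0 := by
    rw [coeff_sum]
    exact sum_eq_zero fun i _ => (hp i).coeff_eq_zero (by rw [i.2]; exact hk.symm)
  rw [(hs m).unique (hasSum_single m.degree hfiber), coeff_sum]
  refine (hasSum_subtype_iff_of_support_subset (s := {i | d i = m.degree}) fun i hi => ?_).mp
    (hasSum_fintype fun i : {i // d i = m.degree} => coeff m (p i))
  by_contra hd
  exact hi ((hp i).coeff_eq_zero (Ne.symm hd))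

/-- The standard tableaux with `k` cells. -/
abbrev TableauOfCard (k : ℕ) : Type :=
  {T : Σ μ, StandardTableau μ // T.1.card = k}

namespace TableauOfCard

variable {k : ℕ}

instance : Unique (TableauOfCard 0) where
  default :=
    ⟨⟨column 0, .ofLT (fun _ => 0) (fun _ hc => absurd (mem_column.mp hc).1 (Nat.not_lt_zero _))
      (by simp [column, YoungDiagram.card]) fun _ _ => rfl⟩, rfl⟩
  uniq T := Subtype.ext <| StandardTableau.sigma_ext fun i j =>
    Nat.le_zero.mp ((T.1.2.entry_le i j).trans_eq T.2)

theorem firstMissing_eq_one (T : TableauOfCard 0) : T.1.2.firstMissing = 1 :=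
  le_antisymm (T.1.2.firstMissing_le.trans_eq (congrArg Nat.succ T.2))
    (Nat.one_le_iff_ne_zero.mpr T.1.2.isLeast_firstMissing.1.1)

/-- The tableau obtained by adding a cell with entry `k + 1` to a tableau with `k` cells. -/
def addCell (P : Σ T : TableauOfCard k, addableRows T.1.1) : TableauOfCard (k + 1) :=
  ⟨⟨NCHarm.addCell P.1.1.1 P.2, P.1.1.2.add P.2.2⟩, by rw [card_addCell P.2.2, P.1.2]⟩

theorem addCell_injective : Function.Injective (addCell (k := k)) := by
  rintro ⟨⟨⟨μ, T⟩, hμ⟩, r, hr⟩ ⟨⟨⟨ν, U⟩, hν⟩, s, hs⟩ h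
  have hentry (i j : ℕ) : (T.add hr).entry i j = (U.add hs).entry i j :=
    congrArg (fun V : TableauOfCard (k + 1) => V.1.2.entry i j) h
  have hcard : μ.card = ν.card := hμ.trans hν.symm
  have hTU : (⟨μ, T⟩ : Σ μ, StandardTableau μ) = ⟨ν, U⟩ := StandardTableau.sigma_ext fun i j => by
    rw [T.entry_eq_ite_add_entry hr, U.entry_eq_ite_add_entry hs, hentry, hcard]
  obtain rfl : r = s := by
    have hmax : (U.add hs).entry r (μ.rowLen r) = ν.card + 1 := by
      rw [← hentry, ← hcard, T.add_entry_eq_card_add_one_iff]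
    exact congrArg Prod.fst ((U.add_entry_eq_card_add_one_iff hs).mp hmax)
  cases hTU
  rfl

theorem addCell_surjective : Function.Surjective (addCell (k := k)) := by
  rintro ⟨⟨ν, U⟩, hν⟩
  obtain ⟨μ, T, r, hr, h⟩ := U.exists_add_eq (ne_of_eq_of_ne hν k.succ_ne_zero)
  have hμ : μ.card = k := by
    have hcard : (NCHarm.addCell μ r).card = ν.card := congrArg (fun V => V.1.card) h
    rw [card_addCell hr] at hcard
    exact Nat.succ_injective (hcard.trans hν)
  exact ⟨⟨⟨⟨μ, T⟩, hμ⟩, r, hr⟩, Subtype.ext h⟩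

instance (k : ℕ) : Finite (TableauOfCard k) := by
  induction k with
  | zero => infer_instance
  | succ k ih => exact Finite.of_surjective addCell addCell_surjective

instance (k : ℕ) : Fintype (TableauOfCard k) :=
  Fintype.ofFinite _

theorem sum_succ {M : Type*} [AddCommMonoid M] (k : ℕ) (f : (Σ μ, StandardTableau μ) → M) :
    ∑ T : TableauOfCard (k + 1), f T.1 =
      ∑ T : TableauOfCard k, ∑ r : addableRows T.1.1,
        f ⟨NCHarm.addCell T.1.1 r, T.1.2.add r.2⟩ := by
  have hbij : Function.Bijective (addCell (k := k)) := ⟨addCell_injective, addCell_surjective⟩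
  rw [← hbij.sum_comp fun T => f T.1, Fintype.sum_sigma]
  rfl

end TableauOfCard

theorem sum_addableRows_ite_eq_colLen {M : Type*} [AddCommMonoid M] (μ : YoungDiagram) (p : Prop)
    [Decidable p] (f : ℕ → M) :
    ∑ r : addableRows μ, (if p ∧ (r : ℕ) = μ.colLen 0 then f r else 0) =
      if p then f (μ.colLen 0) else 0 := by
  rw [sum_coe_sort (addableRows μ) fun r => if p ∧ r = μ.colLen 0 then f r else 0]
  simp only [ite_and, sum_ite_irrel, sum_const_zero, sum_ite_eq', colLen_mem_addableRows, if_true]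

/-- Only the tableau whose shape is a column has all its entries in the first column. -/
theorem sum_ite_firstMissing_eq {M : Type*} [AddCommMonoid M] (k : ℕ) (f : YoungDiagram → M) :
    ∑ T : TableauOfCard k, (if T.1.2.firstMissing = k + 1 then f T.1.1 else 0) = f (column k) := by
  induction k generalizing f with
  | zero =>
    rw [Fintype.sum_unique, if_pos (TableauOfCard.firstMissing_eq_one _)]
    rfl
  | succ k ih =>
    have hrow (T : TableauOfCard k) :
        ∑ r : addableRows T.1.1,
          (if (T.1.2.add r.2).firstMissing = k + 2 then f (addCell T.1.1 r) else 0) =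
          if T.1.2.firstMissing = k + 1 then f (addCell T.1.1 (T.1.1.colLen 0)) else 0 := by
      rw [← sum_addableRows_ite_eq_colLen _ _ fun r => f (addCell T.1.1 r)]
      refine Fintype.sum_congr _ _ fun r => if_congr ?_ rfl rfl
      have hiff := T.1.2.firstMissing_add_eq_card_add_two_iff r.2
      rwa [T.2] at hiff
    rw [TableauOfCard.sum_succ k fun T => if T.2.firstMissing = k + 2 then f T.1 else 0,
      Fintype.sum_congr _ _ hrow, ih fun μ => f (addCell μ (μ.colLen 0)), colLen_zero_column,
      addCell_column]

/-- The sum of the Schur polynomials of the shapes of the standard tableaux with `k` cells whose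
first missing entry in the first column is odd. -/
def oddTableauSum (n k : ℕ) : MvPolynomial (Fin n) ℚ :=
  ∑ T : TableauOfCard k, if Odd T.1.2.firstMissing then schurPoly n T.1.1 else 0

theorem oddTableauSum_zero (n : ℕ) : oddTableauSum n 0 = 1 := by
  rw [oddTableauSum, Fintype.sum_unique, TableauOfCard.firstMissing_eq_one, if_pos odd_one]
  exact (schurPoly_column n 0).trans (esymm_zero _ _)

theorem ite_odd_firstMissing_add {R : Type*} [Ring R] {μ : YoungDiagram} (T : StandardTableau μ)
    {r : ℕ} (hr : r ∈ addableRows μ) (x : R) :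
    (if Odd (T.add hr).firstMissing then x else 0) = (if Odd T.firstMissing then x else 0) +
      if T.firstMissing = μ.card + 1 ∧ r = μ.colLen 0 then (-1) ^ (μ.card + 1) * x else 0 := by
  rw [T.firstMissing_add hr]
  by_cases h : T.firstMissing = μ.card + 1 ∧ r = μ.colLen 0
  · rw [if_pos h, if_pos h, h.1]
    rcases Nat.even_or_odd (μ.card + 1) with hμ | hμ
    · have hsucc : Odd (μ.card + 2) := hμ.add_one
      rw [if_pos hsucc, if_neg (Nat.not_odd_iff_even.mpr hμ), hμ.neg_one_pow, one_mul, zero_add]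
    · have hsucc : Even (μ.card + 2) := hμ.add_one
      rw [if_neg (Nat.not_odd_iff_even.mpr hsucc), if_pos hμ, hμ.neg_one_pow, neg_one_mul,
        add_neg_cancel]
  · rw [if_neg h, if_neg h, add_zero]

theorem oddTableauSum_succ (n k : ℕ) :
    oddTableauSum n (k + 1) =
      (∑ j, X j) * oddTableauSum n k + (-1) ^ (k + 1) * esymm (Fin n) ℚ (k + 1) := by
  have hPieri (T : TableauOfCard k) :
      ∑ r : addableRows T.1.1, (if Odd (T.1.2.add r.2).firstMissing
        then schurPoly n (addCell T.1.1 r) else 0) =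
      (∑ j, X j) * (if Odd T.1.2.firstMissing then schurPoly n T.1.1 else 0) +
        if T.1.2.firstMissing = k + 1
          then (-1) ^ (k + 1) * schurPoly n (addCell T.1.1 (T.1.1.colLen 0)) else 0 := by
    simp only [ite_odd_firstMissing_add, sum_add_distrib, T.2,
      sum_addableRows_ite_eq_colLen T.1.1 _ fun r => (-1) ^ (k + 1) * schurPoly n (addCell T.1.1 r)]
    rw [mul_ite, mul_zero, mul_comm (∑ j, X j), schurPoly_mul_sum_X, sum_ite_irrel, sum_const_zero,
      sum_coe_sort _ fun r => schurPoly n (addCell T.1.1 r)]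
  rw [oddTableauSum,
    TableauOfCard.sum_succ k fun T => if Odd T.2.firstMissing then schurPoly n T.1 else 0]
  simp only [hPieri, sum_add_distrib, ← mul_sum, oddTableauSum]
  rw [sum_ite_firstMissing_eq k fun μ => (-1) ^ (k + 1) * schurPoly n (addCell μ (μ.colLen 0)),
    colLen_zero_column, addCell_column, schurPoly_column]

theorem oddTableauSum_eq_alternatingHookSum (n k : ℕ) :
    oddTableauSum n k = alternatingHookSum (Fin n) ℚ k := by
  induction k with
  | zero => rw [oddTableauSum_zero, alternatingHookSum_zero]
  | succ k ih => rw [oddTableauSum_succ, alternatingHookSum_succ, ih]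

theorem hasSum_schurPoly (n : ℕ) :
    HasSum
      (fun T : {T : Σ μ : YoungDiagram, StandardTableau μ // Odd T.2.firstMissing} =>
        (schurPoly n T.1.1 : MvPowerSeries (Fin n) ℚ))
      ((∏ i : Fin n, (1 - MvPowerSeries.X i)) * (1 - ∑ i : Fin n, MvPowerSeries.X i)⁻¹) := by
  let p (T : Σ μ, StandardTableau μ) : MvPolynomial (Fin n) ℚ :=
    if Odd T.2.firstMissing then schurPoly n T.1 else 0
  have hp (T) : (p T).IsHomogeneous T.1.card := by
    dsimp only [p]
    split_ifs
    · exact isHomogeneous_schurPoly n T.1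
    · exact isHomogeneous_zero _ _ _
  let _ (k : ℕ) : Fintype {T : Σ μ, StandardTableau μ // T.1.card = k} :=
    inferInstanceAs (Fintype (TableauOfCard k))
  have hfiber : HasSum (fun k => (oddTableauSum n k : MvPowerSeries (Fin n) ℚ)) _ :=
    hasSum_alternatingHookSum.congr_fun fun k => by rw [oddTableauSum_eq_alternatingHookSum]
  have hsum := hasSum_of_hasSum_fiber_of_isHomogeneous hp hfiber
  refine (hasSum_subtype_iff_indicator
    (f := fun T : Σ μ, StandardTableau μ => (schurPoly n T.1 : MvPowerSeries (Fin n) ℚ))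
    (s := {T | Odd T.2.firstMissing})).mpr (hsum.congr_fun fun T => ?_)
  simp only [p, Set.indicator_apply, Set.mem_ofPred_eq, apply_ite toMvPowerSeries,
    MvPolynomial.coe_zero]

end NCHarm

end

theorem mainTheorem5 (n : ℕ) :
    ∃ χ : MvPowerSeries (Fin n) ℚ,
      NCHarm.IsCharacterDerivedEnveloping n χ ∧
      χ = (∏ i : Fin n, (1 - MvPowerSeries.X i)) * (1 - ∑ i : Fin n, MvPowerSeries.X i)⁻¹ ∧
      HasSum
        (fun k : ℕ => ∑ i ∈ Finset.Icc 2 k,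
          (-1 : MvPowerSeries (Fin n) ℚ) ^ i *
            (NCHarm.elementaryHook n k i : MvPowerSeries (Fin n) ℚ))
        (χ - 1) ∧
      HasSum
        (fun T : {T : Σ μ : YoungDiagram, NCHarm.StandardTableau μ // Odd T.2.firstMissing} =>
          (NCHarm.schurPoly n T.1.1 : MvPowerSeries (Fin n) ℚ))
        χ :=
  ⟨_, NCHarm.isCharacterDerivedEnveloping n, rfl, NCHarm.hasSum_sum_elementaryHook n,
    NCHarm.hasSum_schurPoly n⟩
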